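/- **Theorem (Unknown Domain Binary Mechanism).** Let $U$ be any set of items, $L,\Delta_0\ge 1$ integers, $\varepsilon>0$, and $0<\delta\le 1$ with $\delta\le \Delta_0L/2$. Consider streams $\omega=(\omega^{(1)},\dots,\omega^{(L)})$ of finite sets $\omega^{(\ell)}\subseteq U$ with $|\omega^{(\ell)}|\le\Delta_0$ for all $\ell$. Two streams are event-level adjacent if they agree in all rounds except possibly one, and in that round one of the two events is empty. For $1\le r\le L$ write $r=2^{j_1}+\dots+2^{j_m}$ with $j_1>\dots>j_m$, and let $\mathcal D(r)$ be the corresponding partition of $\{1,\dots,r\}$ into consecutive blocks of lengths $2^{j_1},\dots,2^{j_m}$, in this order (so $\mathcal D(10)=\{\{1,\dots,8\},\{9,10\}\}$). Let $\sigma=1/\varepsilon$ and let $Z_{I,u}\sim \mathrm N(0,\sigma^2)$ be independent for all blocks $I$ and items $u$. The unknown-domain Binary Mechanism with threshold $T$ releases, in each round $r=1,\dots,L$, the histogram of all pairs $(u,\tilde c_r(u))$ with $$u\in\omega^{(1)}\cup\dots\cup\omega^{(r)},\qquad \tilde c_r(u)=\sum_{I\in\mathcal D(r)}\Big(\sum_{j\in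 I}\mathbf 1\{u\in\omega^{(j)}\}+Z_{I,u}\Big)>T ;$$ its output is the sequence of the $L$ released histograms, each regarded as a map that assigns to an item its noisy count or "not released" (with the product $\sigma$-algebra over rounds and items). Let $$T=1+\sigma\sqrt{\lceil\log_2(L+1)\rceil+1}\;\Phi^{-1}\!\Big(1-\frac{\delta}{\Delta_0L}\Big),$$ where $\Phi$ is the distribution function of the standard normal law. Then this mechanism $A$ is $\delta$-approximate $\rho$-CDP under event-level adjacency, with $\rho=\Delta_0\lceil\log_2(L+1)\rceil\varepsilon^2/2$. That is, for all adjacent streams $\omega,\omega'$ there are probability measures $P',P'',Q',Q''$ such that $A(\omega)\sim(1-\delta)P'+\delta P''$, $A(\omega')\sim(1-\delta)Q'+\delta Q''$, and for all real $\lambda\ge1$ the Rényi divergences of order $\lambda$ satisfy $D_\lambda(P'\|Q')\le\rho\lambda$ and $D_\lambda(Q'\|P')\le\rho\lambda$ (where $D_1$ is the Kullback–Leibler divergence). -/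

import Mathlib

open MeasureTheory ProbabilityTheory

namespace UnknownDomain

/-! ### Approximate concentrated differential privacy -/

/-- The Rényi divergence `D_α(P ‖ Q)` of order `α ≥ 1` of two probability measures. It is `∞` unless
`P ≪ Q`; it is the Kullback-Leibler divergence for `α = 1` and
`(α - 1)⁻¹ log ∫ (dP/dQ)^α dQ` for `α > 1`. -/
noncomputable def renyiDiv {Y : Type*} [MeasurableSpace Y] (α : ℝ) (P Q : Measure Y) : EReal :=
  open Classical in
  if P ≪ Q then
    if α = 1 then ((InformationTheory.klDiv P Q : ENNReal) : EReal)
    else (((α - 1)⁻¹ : ℝ) : EReal) * ENNReal.log (∫⁻ y, (P.rnDeriv Q y) ^ α ∂Q)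
  else ⊤

/-- `δ`-approximate `ρ`-CDP of a randomized algorithm, given by the laws `A x` of its outputs, with
respect to the neighbouring relation `nbr` on its inputs. -/
def IsApproxCDP {X Y : Type*} [MeasurableSpace Y] (nbr : X → X → Prop) (A : X → Measure Y)
    (δ ρ : ℝ) : Prop :=
  ∀ x x' : X, nbr x x' →
    ∃ P' P'' Q' Q'' : Measure Y,
      IsProbabilityMeasure P' ∧ IsProbabilityMeasure P'' ∧
      IsProbabilityMeasure Q' ∧ IsProbabilityMeasure Q'' ∧
      A x = ENNReal.ofReal (1 - δ) • P' + ENNReal.ofReal δ • P'' ∧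
      A x' = ENNReal.ofReal (1 - δ) • Q' + ENNReal.ofReal δ • Q'' ∧
      ∀ α : ℝ, 1 ≤ α →
        renyiDiv α P' Q' ≤ ((ρ * α : ℝ) : EReal) ∧ renyiDiv α Q' P' ≤ ((ρ * α : ℝ) : EReal)

/-- The inverse `Φ⁻¹` of the distribution function of the standard normal law (as the quantile
function; meaningful for `0 < p < 1`). -/
noncomputable def normalQuantile (p : ℝ) : ℝ :=
  sInf {x : ℝ | p ≤ cdf (gaussianReal 0 1) x}

/-! ### Streams -/

/-- Streams of `L` events; each event is a finite set of at most `Δ₀` items from `U`. The event of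
round `i + 1` is `ω.1 i`. -/
abbrev EventStream (U : Type*) (L Δ₀ : ℕ) : Type _ :=
  {ω : Fin L → Finset U // ∀ i, (ω i).card ≤ Δ₀}

/-- Event-level adjacency: one event is present in one stream and absent (that is, replaced by the
empty set) in the other one; all other events agree. -/
def EventAdjacent {U : Type*} {L Δ₀ : ℕ} (ω ω' : EventStream U L Δ₀) : Prop :=
  ∃ l : Fin L, (∀ i, i ≠ l → ω.1 i = ω'.1 i) ∧ (ω.1 l = ∅ ∨ ω'.1 l = ∅)

/-! ### The Unknown Domain Binary Mechanism -/

/-- The dyadic intervals of rounds into which the Binary Mechanism splits `{1, …, r}`, one for each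
bit of `r` that is set; the pair `(a, b)` stands for the rounds `a + 1, …, b`.
For instance `10 = 8 + 2` gives `(0, 8)` and `(8, 10)`. -/
def dyadicBlocks (r : ℕ) : Finset (ℕ × ℕ) :=
  ((Finset.range r.size).filter fun j => r.testBit j = true).image fun j =>
    (r / 2 ^ (j + 1) * 2 ^ (j + 1), r / 2 ^ (j + 1) * 2 ^ (j + 1) + 2 ^ j)

/-- The partial sum of the item `u` over the rounds `a + 1, …, b`, where `I = (a, b)`. -/
noncomputable def partialSum {U : Type*} {L : ℕ} (ω : Fin L → Finset U) (u : U) (I : ℕ × ℕ) : ℕ :=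
  open Classical in
  (Finset.univ.filter fun i : Fin L => I.1 < i.1 + 1 ∧ i.1 + 1 ≤ I.2 ∧ u ∈ ω i).card

/-- The noisy running count of `u` after round `r`: the sum of the noisy partial sums over the
blocks of `r`. The noise term `z (I, u)` is used again in each round that uses the block `I`. -/
noncomputable def noisyCount {U : Type*} {L : ℕ} (ω : Fin L → Finset U) (z : (ℕ × ℕ) × U → ℝ)
    (r : ℕ) (u : U) : ℝ :=
  ∑ I ∈ dyadicBlocks r, ((partialSum ω u I : ℝ) + z (I, u))

/-- The measurable structure on `Option ℝ` as the disjoint union of a point and the real line. -/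
instance instMeasurableSpaceOptionReal : MeasurableSpace (Option ℝ) :=
  MeasurableSpace.map some inferInstance

/-- What is released in all rounds: in each round a histogram, which holds for each item either its
noisy count (`some c`) or nothing (`none`, the item is not in the histogram). -/
abbrev Release (U : Type*) (L : ℕ) : Type _ := Fin L → U → Option ℝ

/-- The released histograms for given noise: in round `i + 1` an item is released if it has
occurred in one of the rounds `1, …, i + 1` and its noisy running count is larger than `T`. -/
noncomputable def release {U : Type*} {L : ℕ} (T : ℝ) (ω : Fin L → Finset U)
    (z : (ℕ × ℕ) × U → ℝ) : Release U L :=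
  open Classical in
  fun i u =>
    if (∃ j : Fin L, j ≤ i ∧ u ∈ ω j) ∧ T < noisyCount ω z (i.1 + 1) u then
      some (noisyCount ω z (i.1 + 1) u)
    else none

/-- The law of the noise: independent `N(0, σ²)` variables, one for each block and each item.
(Only the terms of items that have occurred are ever used.) -/
noncomputable def noiseLaw (U : Type*) (σ : ℝ) : Measure ((ℕ × ℕ) × U → ℝ) :=
  Measure.infinitePi fun _ => gaussianReal 0 (σ ^ 2).toNNReal

/-- The Unknown Domain Binary Mechanism with noise `N(0, σ²)` and threshold `T`: the joint law of
the histograms that are released in rounds `1, …, L`. -/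
noncomputable def binaryMechanism {U : Type*} {L Δ₀ : ℕ} (σ T : ℝ) (ω : EventStream U L Δ₀) :
    Measure (Release U L) :=
  (noiseLaw U σ).map (release T ω.1)

lemma measurable_some_real : Measurable (some : ℝ → Option ℝ) := fun _ hs => hs

lemma measurable_noisyCount {U : Type*} {L : ℕ} (ω : Fin L → Finset U) (r : ℕ) (u : U) :
    Measurable fun z => noisyCount ω z r u := by
  unfold noisyCount
  exact Finset.measurable_sum _ fun I _ => (measurable_pi_apply (I, u)).const_add _

lemma measurable_release {U : Type*} {L : ℕ} (T : ℝ) (ω : Fin L → Finset U) :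
    Measurable (release T ω) := by
  classical
  refine measurable_pi_lambda _ fun i => measurable_pi_lambda _ fun u => ?_
  unfold release
  refine Measurable.ite ?_ (measurable_some_real.comp (measurable_noisyCount ω _ u))
    measurable_const
  exact (MeasurableSet.const _).inter
    (measurableSet_lt measurable_const (measurable_noisyCount ω _ u))

instance isProbabilityMeasure_binaryMechanism {U : Type*} {L Δ₀ : ℕ} (σ T : ℝ)
    (ω : EventStream U L Δ₀) : IsProbabilityMeasure (binaryMechanism σ T ω) := by
  have : IsProbabilityMeasure (noiseLaw U σ) := by unfold noiseLaw; infer_instance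
  exact Measure.isProbabilityMeasure_map (measurable_release T ω.1).aemeasurable

end UnknownDomain

namespace UnknownDomain

open scoped ENNReal NNReal

/-! ### Rényi divergence of the image of two measures -/

/-! By symmetry let `ω'` lack the event of round `l`. That event raises by one exactly the partial
sums `(I, u)` with `u ∈ ω l` and `I` a block containing the round. Such blocks number at most one
per bit length, so at most `Δ₀ * n` noise coordinates are affected, where `n = ⌈log₂ (L + 1)⌉`.
Absorb the increments into the noise: write the noise as `(w, x)`, with `x` the affected
coordinates. Both mechanisms then compute the same noisy counts from `(w, x)`, and `x` has
independent coordinates of mean 1 for `ω` and of mean 0 for `ω'` (`noisyCount_spliceNoise_eq`).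

The outputs can still differ at exposed pairs: an item of `ω l` that `ω'` has not shown up to that
round. They agree on the region `K` where no exposed count exceeds `T` (`release_spliceNoise_eq`).
Under the law for `ω` an exposed count is 1 plus a sum of at most `n` noise terms, so the choice of
`T` and a union bound over at most `Δ₀ * L` pairs give `K` probability at least `1 - δ`
(`gaussianProd_rayRegion_safeRay`).

Restricting to `K` must not spoil the divergence. The blocks of a round partition its past, so each
exposed count involves just one coordinate of `x`; for fixed `w` the region is a product of lower
rays (`mem_rayRegion_safeRay`). Let `P` be the mean-1 law conditioned on `K`. Let `Q` have the same
`w`-marginal as `P` and, given `w`, the mean-0 law of `x` conditioned on the box. Lower rays are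
less likely under the larger mean, so `(1 - δ) • Q` is dominated by the mean-0 law without any tail
bound for `ω'`. The `α`-th moments of the likelihood ratios equal the untruncated Gaussian ones
times quotients of box masses, and log-concavity of these masses in the mean gives the untruncated
bound (`exists_renyiDiv_le`). Data processing carries it to the outputs, and order 1 follows by
letting the order decrease to 1. -/

/-- Data processing: the `α`-th moment of the likelihood ratio does not grow under a map. -/
lemma lintegral_rnDeriv_map_rpow_le {Y Z : Type*} [MeasurableSpace Y] [MeasurableSpace Z]
    {Q : Measure Y} [IsProbabilityMeasure Q] {p : Y → ℝ≥0∞} (hp : Measurable p)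
    [IsProbabilityMeasure (Q.withDensity p)] {g : Y → Z} (hg : Measurable g)
    {α : ℝ} (hα : 1 < α) :
    ∫⁻ y, (((Q.withDensity p).map g).rnDeriv (Q.map g) y) ^ α ∂(Q.map g)
      ≤ ∫⁻ y, p y ^ α ∂Q := by
  have hα0 : 0 < α := by linarith
  have : IsProbabilityMeasure (Q.map g) := Measure.isProbabilityMeasure_map hg.aemeasurable
  have : IsProbabilityMeasure ((Q.withDensity p).map g) :=
    Measure.isProbabilityMeasure_map hg.aemeasurable
  set h := ((Q.withDensity p).map g).rnDeriv (Q.map g) with hh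
  have hac : (Q.withDensity p).map g ≪ Q.map g :=
    (withDensity_absolutelyContinuous Q p).map hg
  have hmeas : Measurable h := Measure.measurable_rnDeriv _ _
  -- Truncating at `n` makes the moment `X` finite, so a power of `X` can be cancelled from the
  -- Hölder bound `X ≤ C ^ (1 / α) * X ^ (1 - 1 / α)`. Monotone convergence then removes the
  -- truncation.
  have key : ∀ n : ℕ, ∫⁻ y, (min (h y) n) ^ α ∂(Q.map g) ≤ ∫⁻ y, p y ^ α ∂Q := by
    intro n
    have hm : Measurable fun y => min (h y) (n : ℝ≥0∞) := hmeas.min measurable_const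
    set X := ∫⁻ y, (min (h y) n) ^ α ∂(Q.map g) with hX
    set C := ∫⁻ y, p y ^ α ∂Q with hC
    have hXtop : X ≠ ∞ := by
      refine ne_top_of_le_ne_top (b := ∫⁻ _, (n : ℝ≥0∞) ^ α ∂(Q.map g)) ?_ ?_
      · simp [ENNReal.rpow_eq_top_iff, hα0.le]
      · exact lintegral_mono fun y => ENNReal.rpow_le_rpow (min_le_right _ _) hα0.le
    have hpq : α.HolderConjugate (α / (α - 1)) := Real.HolderConjugate.conjExponent hα
    have h1 : X ≤ C ^ (1 / α) * X ^ (1 / (α / (α - 1))) := by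
      calc X ≤ ∫⁻ y, h y * (min (h y) n) ^ (α - 1) ∂(Q.map g) := by
            refine lintegral_mono fun y => ?_
            have : (min (h y) (n : ℝ≥0∞)) ^ α
                = min (h y) n * (min (h y) (n : ℝ≥0∞)) ^ (α - 1) := by
              conv_lhs => rw [show α = 1 + (α - 1) by ring]
              rw [ENNReal.rpow_add_of_nonneg _ _ zero_le_one (by linarith), ENNReal.rpow_one]
            rw [this]
            gcongr
            exact min_le_left _ _
        _ = ∫⁻ y, (min (h y) n) ^ (α - 1) ∂((Q.withDensity p).map g) :=
            lintegral_rnDeriv_mul hac (hm.pow_const _).aemeasurable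
        _ = ∫⁻ y, (min (h (g y)) n) ^ (α - 1) ∂(Q.withDensity p) :=
            lintegral_map (hm.pow_const _) hg
        _ = ∫⁻ y, (p * fun y => (min (h (g y)) n) ^ (α - 1)) y ∂Q :=
            lintegral_withDensity_eq_lintegral_mul _ hp ((hm.comp hg).pow_const _)
        _ ≤ C ^ (1 / α) * (∫⁻ y, ((min (h (g y)) n) ^ (α - 1)) ^ (α / (α - 1)) ∂Q)
              ^ (1 / (α / (α - 1))) :=
            ENNReal.lintegral_mul_le_Lp_mul_Lq Q hpq hp.aemeasurable
              ((hm.comp hg).pow_const _).aemeasurable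
        _ = C ^ (1 / α) * X ^ (1 / (α / (α - 1))) := by
            congr 2
            rw [hX, lintegral_map (hm.pow_const _) hg]
            refine lintegral_congr fun y => ?_
            rw [← ENNReal.rpow_mul]
            congr 1
            field_simp [show α - 1 ≠ 0 by linarith]
    rcases eq_or_ne X 0 with hX0 | hX0
    · simp [hX0]
    have h2 : X ^ (1 / α) * X ^ (1 / (α / (α - 1))) = X := by
      rw [← ENNReal.rpow_add _ _ hX0 hXtop]
      have : 1 / α + 1 / (α / (α - 1)) = 1 := by field_simp; ring
      rw [this, ENNReal.rpow_one]
    have h3 : X ^ (1 / α) ≤ C ^ (1 / α) := by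
      have hne0 : X ^ (1 / (α / (α - 1))) ≠ 0 := by
        simp [ENNReal.rpow_eq_zero_iff, hX0, hXtop]
      have hnet : X ^ (1 / (α / (α - 1))) ≠ ∞ := by
        simp [ENNReal.rpow_eq_top_iff, hX0, hXtop]
      conv_lhs at h1 => rw [← h2]
      exact (ENNReal.mul_le_mul_iff_left hne0 hnet).1 h1
    exact (ENNReal.rpow_le_rpow_iff (by positivity)).1 h3
  have hlim : Filter.Tendsto (fun n : ℕ => ∫⁻ y, (min (h y) n) ^ α ∂(Q.map g)) Filter.atTop
      (nhds (∫⁻ y, h y ^ α ∂(Q.map g))) := by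
    refine lintegral_tendsto_of_tendsto_of_monotone
      (fun n => ((hmeas.min measurable_const).pow_const _).aemeasurable)
      (ae_of_all _ fun y m n hmn => ?_) (ae_of_all _ fun y => ?_)
    · exact ENNReal.rpow_le_rpow (min_le_min_left _ (by exact_mod_cast hmn)) hα0.le
    · refine (ENNReal.continuous_rpow_const.tendsto _).comp ?_
      have := (tendsto_const_nhds (x := h y)).min ENNReal.tendsto_nat_nhds_top
      simpa using this
  exact le_of_tendsto' hlim key

/-- This is `log t ≤ t - 1` at `t = x ^ β / C`, multiplied by `x / β`. Integrated with `C` a bound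
for the moment of order `1 + β`, it bounds the Kullback–Leibler divergence by `log C / β`. -/
lemma klFun_add_le {β C x : ℝ} (hβ : 0 < β) (hC : 0 < C) (hx : 0 ≤ x) :
    InformationTheory.klFun x + (1 / β + 1) * x
      ≤ 1 / (β * C) * x ^ (1 + β) + Real.log C / β * x + 1 := by
  rw [InformationTheory.klFun_apply]
  rcases hx.eq_or_lt with rfl | hx
  · simp [Real.zero_rpow (by linarith : 1 + β ≠ 0)]
  have h1 : Real.log (x ^ β / C) ≤ x ^ β / C - 1 := Real.log_le_sub_one_of_pos (by positivity)
  rw [Real.log_div (by positivity) hC.ne', Real.log_rpow hx] at h1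
  rw [Real.rpow_add hx, Real.rpow_one]
  have h2 : x / β * (β * Real.log x - Real.log C) ≤ x / β * (x ^ β / C - 1) := by gcongr
  have e1 : x / β * (β * Real.log x - Real.log C) = x * Real.log x - Real.log C / β * x := by
    field_simp
  have e2 : x / β * (x ^ β / C - 1) = 1 / (β * C) * (x * x ^ β) - 1 / β * x := by
    field_simp
  linarith

lemma klDiv_le_of_lintegral_rpow_le {Y : Type*} [MeasurableSpace Y] {P Q : Measure Y}
    [IsProbabilityMeasure P] [IsProbabilityMeasure Q] (hac : P ≪ Q) {β D : ℝ} (hβ : 0 < β)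
    (hD : 0 ≤ D)
    (h : ∫⁻ y, (P.rnDeriv Q y) ^ (1 + β) ∂Q ≤ ENNReal.ofReal (Real.exp (β * D))) :
    InformationTheory.klDiv P Q ≤ ENNReal.ofReal D := by
  rw [InformationTheory.klDiv_eq_lintegral_klFun_of_ac hac]
  set r := P.rnDeriv Q
  set C := Real.exp (β * D) with hC
  have hCpos : 0 < C := Real.exp_pos _
  have hr : Measurable r := Measure.measurable_rnDeriv _ _
  have hint : ∫⁻ y, r y ∂Q = 1 := by
    rw [Measure.lintegral_rnDeriv hac, measure_univ]
  have hlog : Real.log C / β = D := by rw [hC, Real.log_exp]; field_simp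
  -- The negative linear term stands on the left, so every term is nonnegative and the inequality
  -- survives in `ℝ≥0∞`.
  have hpt : ∀ᵐ y ∂Q, ENNReal.ofReal (InformationTheory.klFun (r y).toReal)
      + ENNReal.ofReal (1 / β + 1) * r y
      ≤ ENNReal.ofReal (1 / (β * C)) * r y ^ (1 + β) + (ENNReal.ofReal D * r y + 1) := by
    filter_upwards [P.rnDeriv_lt_top Q] with y hy
    have hx : 0 ≤ (r y).toReal := ENNReal.toReal_nonneg
    have e : r y = ENNReal.ofReal (r y).toReal := (ENNReal.ofReal_toReal hy.ne).symm
    have := klFun_add_le hβ hCpos hx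
    rw [hlog] at this
    generalize (r y).toReal = x at *
    rw [e, ENNReal.ofReal_rpow_of_nonneg hx (by linarith), ← ENNReal.ofReal_mul (by positivity),
      ← ENNReal.ofReal_mul (by positivity), ← ENNReal.ofReal_mul hD, ← ENNReal.ofReal_one,
      ← ENNReal.ofReal_add (InformationTheory.klFun_nonneg hx) (by positivity),
      ← ENNReal.ofReal_add (by positivity) zero_le_one,
      ← ENNReal.ofReal_add (by positivity) (by positivity)]
    exact ENNReal.ofReal_le_ofReal (by linarith)
  have h1 := lintegral_mono_ae hpt
  rw [lintegral_add_right _ (hr.const_mul _), lintegral_const_mul _ hr, hint, mul_one,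
    lintegral_add_right _ ((hr.const_mul _).add_const _), lintegral_const_mul _ (hr.pow_const _),
    lintegral_add_right _ measurable_const, lintegral_const_mul _ hr, hint, lintegral_one,
    measure_univ, mul_one] at h1
  have h2 : ENNReal.ofReal (1 / (β * C)) * ∫⁻ y, r y ^ (1 + β) ∂Q ≤ ENNReal.ofReal (1 / β) := by
    refine (mul_le_mul_right h _).trans ?_
    rw [← ENNReal.ofReal_mul (by positivity)]
    refine ENNReal.ofReal_le_ofReal (le_of_eq ?_)
    field_simp
  have h3 := h1.trans (add_le_add_left h2 _)
  rw [← ENNReal.ofReal_one, ← ENNReal.ofReal_add hD zero_le_one,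
    ← ENNReal.ofReal_add (by positivity) (by positivity),
    show 1 / β + (D + 1) = D + (1 / β + 1) by ring,
    ENNReal.ofReal_add hD (by positivity)] at h3
  exact (ENNReal.add_le_add_iff_right ENNReal.ofReal_ne_top).1 h3

/-- If all moments of a density `p` grow at most like those of a Gaussian shift, the Rényi
divergences of the images under any map are bounded as for concentrated differential privacy. -/
lemma renyiDiv_map_le {Y Z : Type*} [MeasurableSpace Y] [MeasurableSpace Z]
    {Q : Measure Y} [IsProbabilityMeasure Q] {p : Y → ℝ≥0∞} (hp : Measurable p)
    [IsProbabilityMeasure (Q.withDensity p)] {g : Y → Z} (hg : Measurable g)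
    {ρ : ℝ} (hρ : 0 ≤ ρ)
    (h : ∀ α : ℝ, 1 < α → ∫⁻ y, p y ^ α ∂Q ≤ ENNReal.ofReal (Real.exp ((α - 1) * (ρ * α))))
    {α : ℝ} (hα : 1 ≤ α) :
    renyiDiv α ((Q.withDensity p).map g) (Q.map g) ≤ ((ρ * α : ℝ) : EReal) := by
  have : IsProbabilityMeasure (Q.map g) := Measure.isProbabilityMeasure_map hg.aemeasurable
  have : IsProbabilityMeasure ((Q.withDensity p).map g) :=
    Measure.isProbabilityMeasure_map hg.aemeasurable
  have hac : (Q.withDensity p).map g ≪ Q.map g :=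
    (withDensity_absolutelyContinuous Q p).map hg
  have hmom : ∀ α : ℝ, 1 < α →
      ∫⁻ y, (((Q.withDensity p).map g).rnDeriv (Q.map g) y) ^ α ∂(Q.map g)
        ≤ ENNReal.ofReal (Real.exp ((α - 1) * (ρ * α))) := fun α hα =>
    (lintegral_rnDeriv_map_rpow_le hp hg hα).trans (h α hα)
  rw [renyiDiv, if_pos hac]
  rcases hα.eq_or_lt with rfl | hα
  · rw [if_pos rfl, mul_one]
    have hkl : InformationTheory.klDiv ((Q.withDensity p).map g) (Q.map g)
        ≤ ENNReal.ofReal ρ := by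
      -- The moment of order `1 + β` bounds the divergence by `ρ * (1 + β)` for each `β > 0`; now
      -- let `β` tend to 0.
      have hlim : Filter.Tendsto (fun β : ℝ => ENNReal.ofReal (ρ * (1 + β)))
          (nhdsWithin 0 (Set.Ioi 0)) (nhds (ENNReal.ofReal ρ)) := by
        have hc : Continuous fun β : ℝ => ENNReal.ofReal (ρ * (1 + β)) :=
          ENNReal.continuous_ofReal.comp (by fun_prop)
        have := hc.tendsto 0
        simp only [add_zero, mul_one] at this
        exact this.mono_left nhdsWithin_le_nhds
      refine ge_of_tendsto hlim ?_
      filter_upwards [self_mem_nhdsWithin] with β hβ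
      have hβ : 0 < β := hβ
      refine klDiv_le_of_lintegral_rpow_le hac hβ (by positivity) ?_
      simpa using hmom (1 + β) (by linarith)
    calc ((InformationTheory.klDiv ((Q.withDensity p).map g) (Q.map g) : ℝ≥0∞) : EReal)
        ≤ ((ENNReal.ofReal ρ : ℝ≥0∞) : EReal) := by exact_mod_cast hkl
      _ = (ρ : EReal) := by rw [EReal.coe_ennreal_ofReal, max_eq_left hρ]
  · rw [if_neg hα.ne']
    have h1 := ENNReal.log_le_log (hmom α hα)
    rw [ENNReal.log_ofReal_of_pos (Real.exp_pos _), Real.log_exp] at h1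
    have hpos : 0 < α - 1 := by linarith
    calc _ ≤ (((α - 1)⁻¹ : ℝ) : EReal) * (((α - 1) * (ρ * α) : ℝ) : EReal) := by
          refine mul_le_mul_of_nonneg_left h1 ?_
          exact_mod_cast (inv_pos.2 hpos).le
      _ = _ := by
          rw [← EReal.coe_mul]
          congr 1
          field_simp

/-- A probability measure that is dominated by `A` up to the factor `1 - δ` is the main part of a
mixture representation of `A`. -/
lemma exists_mixture {Y : Type*} [MeasurableSpace Y] {A P : Measure Y} [IsProbabilityMeasure A]
    [IsProbabilityMeasure P] {δ : ℝ} (hδ : 0 < δ) (hδ1 : δ ≤ 1)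
    (h : ENNReal.ofReal (1 - δ) • P ≤ A) :
    ∃ P'' : Measure Y, IsProbabilityMeasure P'' ∧
      A = ENNReal.ofReal (1 - δ) • P + ENNReal.ofReal δ • P'' := by
  have hfin : IsFiniteMeasure (ENNReal.ofReal (1 - δ) • P) := P.smul_finite ENNReal.ofReal_ne_top
  have hδ0 : ENNReal.ofReal δ ≠ 0 := by simpa using hδ
  have hsum : ENNReal.ofReal (1 - δ) + ENNReal.ofReal δ = 1 := by
    rw [← ENNReal.ofReal_add (by linarith) hδ.le]
    simp
  -- The second component is the normalised remainder `(A - (1 - δ) • P) / δ`.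
  have hrec : A = ENNReal.ofReal (1 - δ) • P
      + ENNReal.ofReal δ • ((ENNReal.ofReal δ)⁻¹ • (A - ENNReal.ofReal (1 - δ) • P)) := by
    rw [smul_smul, ENNReal.mul_inv_cancel hδ0 ENNReal.ofReal_ne_top, one_smul, add_comm,
      Measure.sub_add_cancel_of_le h]
  refine ⟨_, ⟨?_⟩, hrec⟩
  rw [Measure.smul_apply, Measure.sub_apply MeasurableSet.univ h, measure_univ, Measure.smul_apply,
    measure_univ, smul_eq_mul, smul_eq_mul, mul_one,
    ENNReal.sub_eq_of_eq_add_rev ENNReal.ofReal_ne_top hsum.symm, ENNReal.inv_mul_cancel hδ0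
    ENNReal.ofReal_ne_top]

/-! ### One-dimensional Gaussian measures of half-lines -/

/-- The sets `(-∞, t]` and `ℝ`. -/
def IsLowerRay (J : Set ℝ) : Prop := (∃ t, J = Set.Iic t) ∨ J = Set.univ

lemma IsLowerRay.measurableSet {J : Set ℝ} (hJ : IsLowerRay J) : MeasurableSet J := by
  rcases hJ with ⟨t, rfl⟩ | rfl <;> measurability

lemma gaussianReal_Iic_shift (b : ℝ) (v : ℝ≥0) (t : ℝ) :
    gaussianReal b v (Set.Iic t) = gaussianReal 0 v (Set.Iic (t - b)) := by
  have h := gaussianReal_map_add_const (μ := 0) (v := v) b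
  rw [zero_add] at h
  rw [← h, Measure.map_apply (by fun_prop) measurableSet_Iic]
  congr 1
  ext x
  simp [le_sub_iff_add_le]

lemma IsLowerRay.gaussianReal_ne_zero {J : Set ℝ} (hJ : IsLowerRay J) (b : ℝ) {v : ℝ≥0}
    (hv : v ≠ 0) : gaussianReal b v J ≠ 0 := by
  intro h
  have := gaussianReal_absolutelyContinuous' b hv h
  rcases hJ with ⟨t, rfl⟩ | rfl <;> simp at this

lemma IsLowerRay.gaussianReal_anti {J : Set ℝ} (hJ : IsLowerRay J) {a b : ℝ} (hab : a ≤ b)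
    (v : ℝ≥0) : gaussianReal b v J ≤ gaussianReal a v J := by
  rcases hJ with ⟨t, rfl⟩ | rfl
  · rw [gaussianReal_Iic_shift, gaussianReal_Iic_shift a]
    exact measure_mono (Set.Iic_subset_Iic.2 (by linarith))
  · simp

lemma hasDerivAt_gaussianReal_Iic {v : ℝ≥0} (hv : v ≠ 0) (x : ℝ) :
    HasDerivAt (fun y => (gaussianReal 0 v).real (Set.Iic y)) (gaussianPDFReal 0 v x) x := by
  have hint := integrable_gaussianPDFReal 0 v
  have hcont : Continuous (gaussianPDFReal 0 v) := by
    rw [gaussianPDFReal_def]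
    fun_prop
  have hF : (fun y => (gaussianReal 0 v).real (Set.Iic y))
      = fun y => (∫ u in Set.Iic 0, gaussianPDFReal 0 v u) + ∫ u in (0 : ℝ)..y,
        gaussianPDFReal 0 v u := by
    ext y
    rw [Measure.real, gaussianReal_apply_eq_integral 0 hv,
      ENNReal.toReal_ofReal (integral_nonneg fun _ => gaussianPDFReal_nonneg _ _ _),
      ← intervalIntegral.integral_Iic_sub_Iic hint.integrableOn hint.integrableOn]
    ring
  rw [hF]
  exact (intervalIntegral.integral_hasDerivAt_right hint.intervalIntegrable
    (hcont.stronglyMeasurableAtFilter _ _) hcont.continuousAt).const_add _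

/-- This says that density over distribution function, the derivative of the logarithm of the
latter, is antitone. After a translation both sides are integrals over `(-∞, x]`, and the integrands
compare because `y² + u² - x² - (u + y - x)² = 2 (y - x) (x - u) ≥ 0`. -/
lemma gaussianPDFReal_mul_real_Iic_le {v : ℝ≥0} (hv : v ≠ 0) {x y : ℝ} (hxy : x ≤ y) :
    gaussianPDFReal 0 v y * (gaussianReal 0 v).real (Set.Iic x)
      ≤ gaussianPDFReal 0 v x * (gaussianReal 0 v).real (Set.Iic y) := by
  have hy : (gaussianReal 0 v).real (Set.Iic y) = (gaussianReal (x - y) v).real (Set.Iic x) := by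
    rw [Measure.real, Measure.real, gaussianReal_Iic_shift (x - y)]
    congr 3
    ring
  have hreal : ∀ b : ℝ, (gaussianReal b v).real (Set.Iic x)
      = ∫ u in Set.Iic x, gaussianPDFReal b v u := fun b => by
    rw [Measure.real, gaussianReal_apply_eq_integral b hv,
      ENNReal.toReal_ofReal (integral_nonneg fun _ => gaussianPDFReal_nonneg _ _ _)]
  rw [hy, hreal, hreal, ← integral_const_mul, ← integral_const_mul]
  refine setIntegral_mono_on ((integrable_gaussianPDFReal _ _).const_mul _).integrableOn
    ((integrable_gaussianPDFReal _ _).const_mul _).integrableOn measurableSet_Iic fun u hu => ?_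
  have hu : u ≤ x := hu
  have hvpos : (0 : ℝ) < v := by exact_mod_cast pos_iff_ne_zero.2 hv
  simp only [gaussianPDFReal]
  rw [mul_mul_mul_comm, mul_mul_mul_comm _ (Real.exp (-(x - 0) ^ 2 / (2 * v))), ← Real.exp_add, ← Real.exp_add, ← add_div, ← add_div]
  refine mul_le_mul_of_nonneg_left (Real.exp_le_exp.2
    (div_le_div_of_nonneg_right ?_ (by positivity))) (by positivity)
  nlinarith [mul_nonneg (sub_nonneg.2 hu) (sub_nonneg.2 hxy)]

lemma concaveOn_log_gaussianReal_Iic {v : ℝ≥0} (hv : v ≠ 0) :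
    ConcaveOn ℝ Set.univ fun y => Real.log ((gaussianReal 0 v).real (Set.Iic y)) := by
  have hpos : ∀ y, 0 < (gaussianReal 0 v).real (Set.Iic y) := fun y =>
    ENNReal.toReal_pos (IsLowerRay.gaussianReal_ne_zero (.inl ⟨y, rfl⟩) 0 hv) (measure_ne_top _ _)
  have hder := fun y => (hasDerivAt_gaussianReal_Iic hv y).log (hpos y).ne'
  refine AntitoneOn.concaveOn_of_deriv convex_univ
    (fun y _ => (hder y).continuousAt.continuousWithinAt)
    (fun y _ => (hder y).differentiableAt.differentiableWithinAt) fun x _ y _ hxy => ?_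
  rw [(hder x).deriv, (hder y).deriv, div_le_div_iff₀ (hpos _) (hpos _)]
  exact gaussianPDFReal_mul_real_Iic_le hv hxy

/-- Log-concavity of the Gaussian measure of a half-line in the mean. -/
lemma IsLowerRay.gaussianReal_mul_rpow_le {J : Set ℝ} (hJ : IsLowerRay J) {v : ℝ≥0} (hv : v ≠ 0)
    (a b : ℝ) {α : ℝ} (hα : 1 < α) :
    gaussianReal (α * a + (1 - α) * b) v J * gaussianReal b v J ^ (α - 1)
      ≤ gaussianReal a v J ^ α := by
  rcases hJ with ⟨t, rfl⟩ | rfl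
  swap
  · simp
  have hα0 : 0 < α := by linarith
  set F := fun y => (gaussianReal 0 v).real (Set.Iic y) with hF
  have hpos : ∀ y, 0 < F y := fun y =>
    ENNReal.toReal_pos (IsLowerRay.gaussianReal_ne_zero (.inl ⟨y, rfl⟩) 0 hv) (measure_ne_top _ _)
  have hE : ∀ c, gaussianReal c v (Set.Iic t) = ENNReal.ofReal (F (t - c)) := fun c => by
    rw [gaussianReal_Iic_shift, hF, ofReal_measureReal]
  obtain ⟨-, hconc⟩ := concaveOn_log_gaussianReal_Iic hv
  -- The mean `a` is the convex combination of `α * a + (1 - α) * b` and `b` with weights `1 / α`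
  -- and `1 - 1 / α`.
  have hc := hconc (Set.mem_univ (t - (α * a + (1 - α) * b))) (Set.mem_univ (t - b))
    (one_div_nonneg.2 hα0.le) (sub_nonneg.2 ((div_le_one hα0).2 hα.le)) (by ring)
  have hmid : (1 / α) • (t - (α * a + (1 - α) * b)) + (1 - 1 / α) • (t - b) = t - a := by
    simp only [smul_eq_mul]
    field_simp
    ring
  rw [hmid] at hc
  simp only [smul_eq_mul] at hc
  change 1 / α * Real.log (F _) + (1 - 1 / α) * Real.log (F _) ≤ Real.log (F _) at hc
  rw [hE, hE, hE, ENNReal.ofReal_rpow_of_pos (hpos _), ENNReal.ofReal_rpow_of_pos (hpos _),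
    ← ENNReal.ofReal_mul (hpos _).le]
  refine ENNReal.ofReal_le_ofReal ?_
  rw [← Real.log_le_log_iff (mul_pos (hpos _) (Real.rpow_pos_of_pos (hpos _) _))
    (Real.rpow_pos_of_pos (hpos _) _), Real.log_mul (hpos _).ne'
    (Real.rpow_pos_of_pos (hpos _) _).ne', Real.log_rpow (hpos _), Real.log_rpow (hpos _)]
  have := mul_le_mul_of_nonneg_left hc hα0.le
  have e : α * (1 / α * Real.log (F (t - (α * a + (1 - α) * b)))
      + (1 - 1 / α) * Real.log (F (t - b)))
      = Real.log (F (t - (α * a + (1 - α) * b))) + (α - 1) * Real.log (F (t - b)) := by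
    field_simp
  linarith

/-- The density of `N(1, v)` with respect to `N(0, v)`. -/
noncomputable def shiftDensity (v : ℝ≥0) (x : ℝ) : ℝ≥0∞ :=
  ENNReal.ofReal (Real.exp ((2 * x - 1) / (2 * v)))

lemma measurable_shiftDensity (v : ℝ≥0) : Measurable (shiftDensity v) := by
  unfold shiftDensity
  fun_prop

lemma shiftDensity_ne_zero (v : ℝ≥0) (x : ℝ) : shiftDensity v x ≠ 0 := by
  simp [shiftDensity, Real.exp_pos]

lemma shiftDensity_ne_top (v : ℝ≥0) (x : ℝ) : shiftDensity v x ≠ ∞ := ENNReal.ofReal_ne_top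

/-- Completing the square: the `β`-th power of the likelihood ratio tilts mean 0 to mean `β`. All
real `β` are needed, with `β = α` and `β = 1 - α` for the two directions of the divergence. -/
lemma setLIntegral_shiftDensity_rpow {v : ℝ≥0} (hv : v ≠ 0) (β : ℝ) {J : Set ℝ}
    (hJ : MeasurableSet J) :
    ∫⁻ x in J, shiftDensity v x ^ β ∂(gaussianReal 0 v)
      = ENNReal.ofReal (Real.exp (β * (β - 1) / (2 * v))) * gaussianReal β v J := by
  have hvpos : (0 : ℝ) < v := by exact_mod_cast pos_iff_ne_zero.2 hv
  rw [gaussianReal_of_var_ne_zero 0 hv, setLIntegral_withDensity_eq_setLIntegral_mul _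
    (measurable_gaussianPDF 0 v) ((measurable_shiftDensity v).pow_const β) hJ,
    gaussianReal_apply β hv, ← lintegral_const_mul _ (measurable_gaussianPDF β v)]
  refine lintegral_congr fun x => ?_
  simp only [Pi.mul_apply, gaussianPDF, shiftDensity, gaussianPDFReal]
  rw [ENNReal.ofReal_rpow_of_pos (Real.exp_pos _), ← Real.exp_mul,
    ← ENNReal.ofReal_mul (by positivity), ← ENNReal.ofReal_mul (by positivity), mul_left_comm,
    mul_assoc, ← Real.exp_add, ← Real.exp_add]
  congr 3
  field_simp
  ring

lemma gaussianReal_one_apply {v : ℝ≥0} (hv : v ≠ 0) {J : Set ℝ} (hJ : MeasurableSet J) :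
    gaussianReal 1 v J = ∫⁻ x in J, shiftDensity v x ∂(gaussianReal 0 v) := by
  have := setLIntegral_shiftDensity_rpow hv 1 hJ
  simpa using this.symm

/-! ### The tail bound that is behind the threshold -/

/-- For `p ≥ 1 / 2` this makes 0 a lower bound of the set whose infimum is `normalQuantile p`. -/
lemma cdf_gaussianReal_lt_half {x : ℝ} (hx : x < 0) : cdf (gaussianReal 0 1) x < 1 / 2 := by
  have hsymm : gaussianReal 0 1 (Set.Ici (-x)) = gaussianReal 0 1 (Set.Iic x) := by
    have h := gaussianReal_map_neg (μ := 0) (v := 1)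
    rw [neg_zero] at h
    conv_rhs => rw [← h, Measure.map_apply measurable_neg measurableSet_Iic]
    congr 1
    ext y
    simp
  have hpos : gaussianReal 0 1 (Set.Ioo x (-x)) ≠ 0 := fun h => by
    have := gaussianReal_absolutelyContinuous' 0 one_ne_zero h
    simp at this
    linarith
  have hsum : (gaussianReal 0 1).real (Set.Iic x) + ((gaussianReal 0 1).real (Set.Ioo x (-x))
      + (gaussianReal 0 1).real (Set.Ici (-x))) ≤ 1 := by
    rw [← measureReal_union, ← measureReal_union]
    · exact measureReal_le_one
    · rw [Set.disjoint_left]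
      rintro y hy (hy' | hy') <;> simp at hy hy' <;> linarith
    · measurability
    · rw [Set.disjoint_left]
      rintro y hy hy'
      simp at hy hy'
      linarith
    · measurability
  have h1 : (gaussianReal 0 1).real (Set.Ici (-x)) = (gaussianReal 0 1).real (Set.Iic x) := by
    rw [Measure.real, hsymm, Measure.real]
  have h2 : 0 < (gaussianReal 0 1).real (Set.Ioo x (-x)) :=
    ENNReal.toReal_pos hpos (measure_ne_top _ _)
  rw [cdf_eq_real]
  linarith

lemma normalQuantile_nonneg {p : ℝ} (hp : 1 / 2 ≤ p) : 0 ≤ normalQuantile p := by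
  refine Real.sInf_nonneg fun x hx => ?_
  by_contra hneg
  have := cdf_gaussianReal_lt_half (not_le.1 hneg)
  have hx : p ≤ cdf (gaussianReal 0 1) x := hx
  linarith

lemma le_cdf_normalQuantile {p : ℝ} (hp : 1 / 2 ≤ p) (hp1 : p < 1) :
    p ≤ cdf (gaussianReal 0 1) (normalQuantile p) := by
  have hcont : Continuous (cdf (gaussianReal 0 1)) := by
    rw [continuous_iff_continuousAt]
    intro x
    have := (hasDerivAt_gaussianReal_Iic (v := 1) one_ne_zero x).continuousAt
    have e : (fun y => (gaussianReal 0 1).real (Set.Iic y)) = cdf (gaussianReal 0 1) := by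
      ext y
      rw [cdf_eq_real]
    rwa [e] at this
  have hclosed : IsClosed {x : ℝ | p ≤ cdf (gaussianReal 0 1) x} :=
    isClosed_le continuous_const hcont
  refine hclosed.csInf_mem ?_ ⟨0, fun x hx => ?_⟩
  · obtain ⟨x, hx⟩ := ((tendsto_cdf_atTop (gaussianReal 0 1)).eventually (lt_mem_nhds hp1)).exists
    exact ⟨x, hx.le⟩
  · by_contra hneg
    have := cdf_gaussianReal_lt_half (not_le.1 hneg)
    have hx : p ≤ cdf (gaussianReal 0 1) x := hx
    linarith

/-- Since `η ≤ 1 / 2` the quantile is nonnegative, so replacing the true `√k` by the larger `√n`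
only raises the threshold. Scaling a standard normal variable, instead of normalising, also covers
variance zero. -/
lemma gaussianReal_Ioi_normalQuantile_le {η σ : ℝ} (hη : 0 < η) (hη1 : η ≤ 1 / 2) (hσ : 0 ≤ σ)
    {k n : ℕ} (hkn : k ≤ n) :
    gaussianReal 0 (k * (σ ^ 2).toNNReal) (Set.Ioi (σ * √n * normalQuantile (1 - η)))
      ≤ ENNReal.ofReal η := by
  have hq := normalQuantile_nonneg (p := 1 - η) (by linarith)
  have hmap := gaussianReal_map_const_mul (μ := 0) (v := 1) (σ * √k)
  have hv : (.mk ((σ * √k) ^ 2) (sq_nonneg _) : ℝ≥0) * 1 = k * (σ ^ 2).toNNReal := by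
    ext
    simp [mul_pow, sq_nonneg, mul_comm]
  rw [mul_zero, hv] at hmap
  rw [← hmap, Measure.map_apply (by fun_prop) measurableSet_Ioi]
  have hsub : (fun x => σ * √k * x) ⁻¹' Set.Ioi (σ * √n * normalQuantile (1 - η))
      ⊆ (Set.Iic (normalQuantile (1 - η)))ᶜ := by
    intro x hx hx'
    have hx : σ * √n * normalQuantile (1 - η) < σ * √k * x := hx
    have hx' : x ≤ normalQuantile (1 - η) := hx'
    have : σ * √k * x ≤ σ * √n * normalQuantile (1 - η) :=
      (mul_le_mul_of_nonneg_left hx' (by positivity)).trans (by gcongr)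
    linarith
  refine (measure_mono hsub).trans ?_
  rw [← ofReal_measureReal, probReal_compl_eq_one_sub measurableSet_Iic, ← cdf_eq_real]
  refine ENNReal.ofReal_le_ofReal ?_
  have := le_cdf_normalQuantile (p := 1 - η) (by linarith) (by linarith)
  linarith

/-! ### Two truncated Gaussian product measures -/

lemma lintegral_pi_prod {ι : Type*} [Fintype ι] (μ : ι → Measure ℝ)
    [∀ i, IsProbabilityMeasure (μ i)] {f : ι → ℝ → ℝ≥0∞} (hf : ∀ i, Measurable (f i)) :
    ∫⁻ x, ∏ i, f i (x i) ∂(Measure.pi μ) = ∏ i, ∫⁻ y, f i y ∂(μ i) := by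
  have hind : iIndepFun (fun i (x : ι → ℝ) => f i (x i)) (Measure.pi μ) :=
    iIndepFun_pi fun i => (hf i).aemeasurable
  rw [lintegral_prod_eq_prod_lintegral_of_indepFun Finset.univ _ hind
    fun i => (hf i).comp (measurable_pi_apply i)]
  refine Finset.prod_congr rfl fun i _ => ?_
  exact (measurePreserving_eval μ i).lintegral_comp (hf i)

section Truncation

variable {ι W : Type*} [Fintype ι]

/-- The points whose real coordinates lie in the rays given by the remaining coordinate. -/
def rayRegion (J : ι → W → Set ℝ) : Set (W × (ι → ℝ)) := {q | ∀ i, q.2 i ∈ J i q.1}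

/-- The Gaussian measure with mean `β` of the box of rays over `w`. -/
noncomputable def rayMass (v : ℝ≥0) (J : ι → W → Set ℝ) (β : ℝ) (w : W) : ℝ≥0∞ :=
  ∏ i, gaussianReal β v (J i w)

/-- The product of a measure with the law of independent `N(β, v)` variables. -/
noncomputable def gaussianProd (ι : Type*) [Fintype ι] [MeasurableSpace W] (κ : Measure W) (v : ℝ≥0) (β : ℝ) :
    Measure (W × (ι → ℝ)) :=
  κ.prod (Measure.pi fun _ => gaussianReal β v)

instance [MeasurableSpace W] (κ : Measure W) [IsProbabilityMeasure κ] (v : ℝ≥0) (β : ℝ) :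
    IsProbabilityMeasure (gaussianProd ι κ v β) := by
  unfold gaussianProd
  infer_instance

/-- The density of `gaussianProd ι κ v 1` with respect to `gaussianProd ι κ v 0`. -/
noncomputable def prodShiftDensity (v : ℝ≥0) (q : W × (ι → ℝ)) : ℝ≥0∞ :=
  ∏ i, shiftDensity v (q.2 i)

lemma measurable_prodShiftDensity [MeasurableSpace W] (v : ℝ≥0) :
    Measurable (prodShiftDensity v : W × (ι → ℝ) → ℝ≥0∞) := by
  unfold prodShiftDensity
  exact Finset.measurable_fun_prod _ fun i _ =>
    (measurable_shiftDensity v).comp ((measurable_pi_apply i).comp measurable_snd)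

lemma prodShiftDensity_ne_zero (v : ℝ≥0) (q : W × (ι → ℝ)) : prodShiftDensity v q ≠ 0 :=
  Finset.prod_ne_zero_iff.2 fun _ _ => shiftDensity_ne_zero _ _

lemma prodShiftDensity_ne_top (v : ℝ≥0) (q : W × (ι → ℝ)) : prodShiftDensity v q ≠ ∞ :=
  ENNReal.prod_ne_top fun _ _ => shiftDensity_ne_top _ _

lemma prodShiftDensity_rpow (v : ℝ≥0) (q : W × (ι → ℝ)) (β : ℝ) :
    prodShiftDensity v q ^ β = ∏ i, shiftDensity v (q.2 i) ^ β :=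
  ENNReal.prod_rpow_of_ne_top (fun _ _ => shiftDensity_ne_top _ _) β |>.symm

lemma gaussianProd_one_eq [MeasurableSpace W] (κ : Measure W) [IsProbabilityMeasure κ]
    {v : ℝ≥0} (hv : v ≠ 0) :
    gaussianProd ι κ v 1 = (gaussianProd ι κ v 0).withDensity (prodShiftDensity v) := by
  have hm : Measurable fun x : ι → ℝ => ∏ i, shiftDensity v (x i) :=
    Finset.measurable_fun_prod _ fun i _ => (measurable_shiftDensity v).comp (measurable_pi_apply i)
  have hpi : (Measure.pi fun _ : ι => gaussianReal 1 v)
      = (Measure.pi fun _ : ι => gaussianReal 0 v).withDensity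
        fun x => ∏ i, shiftDensity v (x i) := by
    refine Measure.pi_eq fun s hs => ?_
    rw [withDensity_apply _ (MeasurableSet.univ_pi hs),
      ← lintegral_indicator (MeasurableSet.univ_pi hs)]
    have : ∀ x : ι → ℝ, (Set.univ.pi s).indicator (fun x => ∏ i, shiftDensity v (x i)) x
        = ∏ i, (s i).indicator (shiftDensity v) (x i) := by
      intro x
      by_cases hx : x ∈ Set.univ.pi s
      · rw [Set.indicator_of_mem hx]
        exact Finset.prod_congr rfl fun i _ => by rw [Set.indicator_of_mem (hx i trivial)]
      · rw [Set.indicator_of_notMem hx]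
        simp only [Set.mem_univ_pi, not_forall] at hx
        obtain ⟨i, hi⟩ := hx
        exact (Finset.prod_eq_zero (Finset.mem_univ i) (Set.indicator_of_notMem hi _)).symm
    simp_rw [this]
    rw [lintegral_pi_prod _ fun i => (measurable_shiftDensity v).indicator (hs i)]
    refine Finset.prod_congr rfl fun i _ => ?_
    rw [lintegral_indicator (hs i), gaussianReal_one_apply hv (hs i)]
  unfold gaussianProd
  rw [hpi, prod_withDensity_right hm]
  rfl

variable {J : ι → W → Set ℝ}

lemma measurableSet_rayRegion [MeasurableSpace W]
    (hJm : ∀ i, MeasurableSet {q : W × ℝ | q.2 ∈ J i q.1}) :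
    MeasurableSet (rayRegion J) := by
  have : rayRegion J = ⋂ i, (fun q : W × (ι → ℝ) => (q.1, q.2 i)) ⁻¹' {q | q.2 ∈ J i q.1} := by
    ext q
    simp [rayRegion]
  rw [this]
  exact MeasurableSet.iInter fun i =>
    (measurable_fst.prodMk ((measurable_pi_apply i).comp measurable_snd)) (hJm i)

lemma measurable_rayMass [MeasurableSpace W] (v : ℝ≥0)
    (hJm : ∀ i, MeasurableSet {q : W × ℝ | q.2 ∈ J i q.1})
    (β : ℝ) : Measurable (rayMass v J β) := by
  unfold rayMass
  exact Finset.measurable_fun_prod _ fun i _ => measurable_measure_prodMk_left (hJm i)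

lemma rayMass_ne_zero {v : ℝ≥0} (hv : v ≠ 0) (hJ : ∀ i w, IsLowerRay (J i w)) (β : ℝ) (w : W) :
    rayMass v J β w ≠ 0 :=
  Finset.prod_ne_zero_iff.2 fun i _ => (hJ i w).gaussianReal_ne_zero β hv

lemma rayMass_le_one (v : ℝ≥0) (J : ι → W → Set ℝ) (β : ℝ) (w : W) : rayMass v J β w ≤ 1 :=
  Finset.prod_le_one' fun _ _ => prob_le_one

lemma rayMass_ne_top (v : ℝ≥0) (J : ι → W → Set ℝ) (β : ℝ) (w : W) : rayMass v J β w ≠ ∞ :=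
  ne_top_of_le_ne_top ENNReal.one_ne_top (rayMass_le_one v J β w)

lemma rayMass_anti (v : ℝ≥0) (hJ : ∀ i w, IsLowerRay (J i w)) {a b : ℝ} (hab : a ≤ b) (w : W) :
    rayMass v J b w ≤ rayMass v J a w :=
  Finset.prod_le_prod' fun i _ => (hJ i w).gaussianReal_anti hab v

lemma rayMass_mul_rpow_le {v : ℝ≥0} (hv : v ≠ 0) (hJ : ∀ i w, IsLowerRay (J i w)) (a b : ℝ)
    {α : ℝ} (hα : 1 < α) (w : W) :
    rayMass v J (α * a + (1 - α) * b) w * rayMass v J b w ^ (α - 1) ≤ rayMass v J a w ^ α := by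
  unfold rayMass
  rw [← ENNReal.prod_rpow_of_nonneg (by linarith), ← ENNReal.prod_rpow_of_nonneg (by linarith),
    ← Finset.prod_mul_distrib]
  exact Finset.prod_le_prod' fun i _ => (hJ i w).gaussianReal_mul_rpow_le hv a b hα

/-- Integration over the Gaussian coordinates. -/
lemma lintegral_rayRegion [MeasurableSpace W] (κ : Measure W) [IsProbabilityMeasure κ]
    {v : ℝ≥0} (hv : v ≠ 0)
    (hJ : ∀ i w, IsLowerRay (J i w)) (hJm : ∀ i, MeasurableSet {q : W × ℝ | q.2 ∈ J i q.1})
    (β : ℝ) {G : W → ℝ≥0∞} (hG : Measurable G) :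
    ∫⁻ q in rayRegion J, prodShiftDensity v q ^ β * G q.1 ∂(gaussianProd ι κ v 0)
      = ENNReal.ofReal (Real.exp (β * (β - 1) * (Fintype.card ι / (2 * v))))
        * ∫⁻ w, rayMass v J β w * G w ∂κ := by
  have hK := measurableSet_rayRegion hJm
  have hind : ∀ q : W × (ι → ℝ),
      (rayRegion J).indicator (fun q => prodShiftDensity v q ^ β * G q.1) q
        = (∏ i, (J i q.1).indicator (fun x => shiftDensity v x ^ β) (q.2 i)) * G q.1 := by
    intro q
    by_cases hq : q ∈ rayRegion J
    · rw [Set.indicator_of_mem hq, prodShiftDensity_rpow]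
      congr 1
      exact Finset.prod_congr rfl fun i _ => by rw [Set.indicator_of_mem (hq i)]
    · rw [Set.indicator_of_notMem hq]
      simp only [rayRegion, Set.mem_ofPred_eq, not_forall] at hq
      obtain ⟨i, hi⟩ := hq
      rw [Finset.prod_eq_zero (Finset.mem_univ i) (Set.indicator_of_notMem hi _), zero_mul]
  have hmeas : Measurable ((rayRegion J).indicator
      fun q : W × (ι → ℝ) => prodShiftDensity v q ^ β * G q.1) :=
    (((measurable_prodShiftDensity v).pow_const β).mul (hG.comp measurable_fst)).indicator hK
  have hmass : Measurable fun w => rayMass v J β w * G w := (measurable_rayMass v hJm β).mul hG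
  rw [← lintegral_indicator hK, gaussianProd, lintegral_prod _ hmeas.aemeasurable,
    ← lintegral_const_mul _ hmass]
  refine lintegral_congr fun w => ?_
  simp_rw [hind]
  have hm : ∀ i, Measurable ((J i w).indicator fun x => shiftDensity v x ^ β) := fun i =>
    ((measurable_shiftDensity v).pow_const β).indicator (hJ i w).measurableSet
  have hprod : Measurable fun x : ι → ℝ =>
      ∏ i, (J i w).indicator (fun x => shiftDensity v x ^ β) (x i) :=
    Finset.measurable_fun_prod _ fun i _ => (hm i).comp (measurable_pi_apply i)
  rw [lintegral_mul_const _ hprod, lintegral_pi_prod _ hm, ← mul_assoc]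
  congr 1
  simp_rw [lintegral_indicator (hJ _ w).measurableSet,
    setLIntegral_shiftDensity_rpow hv β (hJ _ w).measurableSet]
  rw [Finset.prod_mul_distrib, Finset.prod_const, Finset.card_univ,
    ← ENNReal.ofReal_pow (Real.exp_pos _).le, ← Real.exp_nat_mul, rayMass]
  congr 3
  ring

/-- Puts the log-concavity bound into the form in which the masses enter the moments: a normalising
quotient to the power `α` times its inverse. -/
lemma mul_div_rpow_le {x a b : ℝ≥0∞} (ha : a ≠ 0) (ha' : a ≠ ∞) (hb : b ≠ 0) (hb' : b ≠ ∞)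
    {α : ℝ} (hα : 1 < α) (h : x * b ^ (α - 1) ≤ a ^ α) :
    x * ((b / a) ^ α * (a / b)) ≤ a := by
  have e : (b / a) ^ α * (a / b) = b ^ (α - 1) * (a ^ (α - 1))⁻¹ := by
    have h0 : b / a ≠ 0 := ENNReal.div_ne_zero.2 ⟨hb, ha'⟩
    have h1 : b / a ≠ ∞ := ENNReal.div_ne_top hb' ha
    rw [← ENNReal.inv_div (a := b) (b := a) (.inl ha') (.inl ha), ← ENNReal.rpow_neg_one (b / a),
      ← ENNReal.rpow_add _ _ h0 h1, ← sub_eq_add_neg, ENNReal.div_rpow_of_nonneg _ _ (by linarith),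
      div_eq_mul_inv]
  have ha1 : a ^ (α - 1) ≠ 0 := by simp [ENNReal.rpow_eq_zero_iff, ha, ha']
  have ha2 : a ^ (α - 1) ≠ ∞ := by simp [ENNReal.rpow_eq_top_iff, ha, ha']
  rw [e, ← mul_assoc, ← div_eq_mul_inv, ENNReal.div_le_iff ha1 ha2]
  refine h.trans (le_of_eq ?_)
  conv_lhs => rw [show α = 1 + (α - 1) by ring]
  rw [ENNReal.rpow_add _ _ ha ha', ENNReal.rpow_one]

/-- If `g₁` and `g` agree on a region of rays that has probability at least `1 - δ` under the
shifted law, then the two image measures are close up to a part of mass `δ` each. -/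
theorem exists_renyiDiv_le {Y : Type*} [MeasurableSpace Y] [MeasurableSpace W] (κ : Measure W)
    [IsProbabilityMeasure κ] {v : ℝ≥0} (hv : v ≠ 0) (hJ : ∀ i w, IsLowerRay (J i w))
    (hJm : ∀ i, MeasurableSet {q : W × ℝ | q.2 ∈ J i q.1}) {g g₁ : W × (ι → ℝ) → Y}
    (hg : Measurable g) (hg₁ : Measurable g₁) (hgg : ∀ q ∈ rayRegion J, g₁ q = g q) {d : ℝ≥0∞}
    (hd : d ≤ gaussianProd ι κ v 1 (rayRegion J)) :
    ∃ P Q : Measure Y, IsProbabilityMeasure P ∧ IsProbabilityMeasure Q ∧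
      d • P ≤ (gaussianProd ι κ v 1).map g₁ ∧ d • Q ≤ (gaussianProd ι κ v 0).map g ∧
      ∀ α : ℝ, 1 ≤ α →
        renyiDiv α P Q ≤ ((Fintype.card ι / (2 * v) * α : ℝ) : EReal) ∧
        renyiDiv α Q P ≤ ((Fintype.card ι / (2 * v) * α : ℝ) : EReal) := by
  have hK := measurableSet_rayRegion hJm
  set m := gaussianProd ι κ v 0 with hm
  set D : W × (ι → ℝ) → ℝ≥0∞ := prodShiftDensity v with hD
  have hDm : Measurable D := measurable_prodShiftDensity v
  have hD0 : ∀ q, D q ≠ 0 := prodShiftDensity_ne_zero v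
  have hDt : ∀ q, D q ≠ ∞ := prodShiftDensity_ne_top v
  have hZm := measurable_rayMass (J := J) v hJm
  have hZ0 := rayMass_ne_zero hv hJ
  have hZt := rayMass_ne_top v J
  -- Weighting the mean-0 law on the region by `R` gives `w` the marginal density proportional to
  -- `rayMass v J 1`, the same as under the conditioned mean-1 law.
  set R : W → ℝ≥0∞ := fun w => rayMass v J 1 w / rayMass v J 0 w with hR
  have hRm : Measurable R := (hZm 1).div (hZm 0)
  have hR0 : ∀ w, R w ≠ 0 := fun w => ENNReal.div_ne_zero.2 ⟨hZ0 1 w, hZt 0 w⟩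
  have hRt : ∀ w, R w ≠ ∞ := fun w => ENNReal.div_ne_top (hZt 1 w) (hZ0 0 w)
  have hRinv : ∀ w, (R w)⁻¹ = rayMass v J 0 w / rayMass v J 1 w := fun w =>
    ENNReal.inv_div (.inl (hZt 0 w)) (.inl (hZ0 0 w))
  set c := ∫⁻ w, rayMass v J 1 w ∂κ with hc
  have hc1 : c ≤ 1 := by
    calc c ≤ ∫⁻ _, 1 ∂κ := lintegral_mono fun w => rayMass_le_one v J 1 w
      _ = 1 := by simp
  have hct : c ≠ ∞ := ne_top_of_le_ne_top ENNReal.one_ne_top hc1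
  have hc0 : c ≠ 0 := by
    rw [hc, Ne, lintegral_eq_zero_iff (hZm 1)]
    intro h
    obtain ⟨w, hw⟩ := h.exists
    exact hZ0 1 w hw
  have hD1 : ∫⁻ q in rayRegion J, D q ∂m = c := by
    simpa [hm, hD, hc] using lintegral_rayRegion κ hv hJ hJm 1 (G := fun _ => 1) measurable_const
  have hR1 : ∫⁻ q in rayRegion J, R q.1 ∂m = c := by
    have h := lintegral_rayRegion κ hv hJ hJm 0 hRm
    simp only [ENNReal.rpow_zero, one_mul, zero_mul, Real.exp_zero, ENNReal.ofReal_one] at h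
    rw [hm, h]
    exact lintegral_congr fun w => ENNReal.mul_div_cancel (hZ0 0 w) (hZt 0 w)
  set a : W × (ι → ℝ) → ℝ≥0∞ := fun q => c⁻¹ * D q with ha
  set b : W × (ι → ℝ) → ℝ≥0∞ := fun q => c⁻¹ * R q.1 with hb
  have ham : Measurable a := hDm.const_mul _
  have hR' : Measurable fun q : W × (ι → ℝ) => R q.1 := hRm.comp measurable_fst
  have hbm : Measurable b := hR'.const_mul _
  set Pt := (m.restrict (rayRegion J)).withDensity a with hPt
  set Qt := (m.restrict (rayRegion J)).withDensity b with hQt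
  have hPprob : IsProbabilityMeasure Pt := ⟨by
    rw [hPt, withDensity_apply _ MeasurableSet.univ, Measure.restrict_univ,
      lintegral_const_mul _ hDm, hD1, ENNReal.inv_mul_cancel hc0 hct]⟩
  have hQprob : IsProbabilityMeasure Qt := ⟨by
    rw [hQt, withDensity_apply _ MeasurableSet.univ, Measure.restrict_univ,
      lintegral_const_mul _ hR', hR1, ENNReal.inv_mul_cancel hc0 hct]⟩
  set p : W × (ι → ℝ) → ℝ≥0∞ := fun q => D q * (R q.1)⁻¹ with hp
  set r : W × (ι → ℝ) → ℝ≥0∞ := fun q => (D q)⁻¹ * R q.1 with hr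
  have hpm : Measurable p := hDm.mul hR'.inv
  have hrm : Measurable r := hDm.inv.mul hR'
  have hPQ : Pt = Qt.withDensity p := by
    rw [hQt, ← withDensity_mul _ hbm hpm, hPt]
    congr 1
    ext q
    simp only [ha, hb, hp, Pi.mul_apply]
    rw [mul_assoc, mul_left_comm (R q.1), ENNReal.mul_inv_cancel (hR0 _) (hRt _), mul_one]
  have hQP : Qt = Pt.withDensity r := by
    rw [hPt, ← withDensity_mul _ ham hrm, hQt]
    congr 1
    ext q
    simp only [ha, hb, hr, Pi.mul_apply]
    rw [mul_assoc, ← mul_assoc (D q), ENNReal.mul_inv_cancel (hD0 _) (hDt _), one_mul]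
  have hPmom : ∀ α : ℝ, 1 < α → ∫⁻ q, p q ^ α ∂Qt
      ≤ ENNReal.ofReal (Real.exp ((α - 1) * (Fintype.card ι / (2 * v) * α))) := by
    intro α hα
    have hG : Measurable fun w => (R w)⁻¹ ^ α * R w := (hRm.inv.pow_const α).mul hRm
    rw [hQt, lintegral_withDensity_eq_lintegral_mul _ hbm (hpm.pow_const α)]
    have e : ∀ q, (b * fun q => p q ^ α) q = c⁻¹ * (D q ^ α * ((R q.1)⁻¹ ^ α * R q.1)) := by
      intro q
      simp only [hb, hp, Pi.mul_apply]
      rw [ENNReal.mul_rpow_of_nonneg _ _ (by linarith)]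
      ring
    simp_rw [e]
    have hm' : Measurable fun q : W × (ι → ℝ) => D q ^ α * ((R q.1)⁻¹ ^ α * R q.1) :=
      (hDm.pow_const _).mul (hG.comp measurable_fst)
    rw [lintegral_const_mul _ hm',
      lintegral_rayRegion κ hv hJ hJm α hG, mul_left_comm]
    -- Log-concavity with `a = 1`, `b = 0`; the reverse divergence below uses `a = 0`, `b = 1`.
    have h1 : ∫⁻ w, rayMass v J α w * ((R w)⁻¹ ^ α * R w) ∂κ ≤ c := by
      refine lintegral_mono fun w => ?_
      have := rayMass_mul_rpow_le hv hJ 1 0 hα w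
      rw [mul_one, mul_zero, add_zero] at this
      simp only [hRinv]
      exact mul_div_rpow_le (hZ0 1 w) (hZt 1 w) (hZ0 0 w) (hZt 0 w) hα this
    calc _ ≤ ENNReal.ofReal (Real.exp (α * (α - 1) * (Fintype.card ι / (2 * v)))) * (c⁻¹ * c) := by
          gcongr
      _ = _ := by
          rw [ENNReal.inv_mul_cancel hc0 hct, mul_one]
          congr 2
          ring
  have hQmom : ∀ α : ℝ, 1 < α → ∫⁻ q, r q ^ α ∂Pt
      ≤ ENNReal.ofReal (Real.exp ((α - 1) * (Fintype.card ι / (2 * v) * α))) := by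
    intro α hα
    have hG : Measurable fun w => R w ^ α := hRm.pow_const α
    rw [hPt, lintegral_withDensity_eq_lintegral_mul _ ham (hrm.pow_const α)]
    have e : ∀ q, (a * fun q => r q ^ α) q = c⁻¹ * (D q ^ (1 - α) * R q.1 ^ α) := by
      intro q
      simp only [ha, hr, Pi.mul_apply]
      rw [ENNReal.mul_rpow_of_nonneg _ _ (by linarith), sub_eq_add_neg,
        ENNReal.rpow_add _ _ (hD0 q) (hDt q), ENNReal.rpow_one, ENNReal.rpow_neg, ENNReal.inv_rpow]
      ring
    simp_rw [e]
    have hm' : Measurable fun q : W × (ι → ℝ) => D q ^ (1 - α) * R q.1 ^ α :=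
      (hDm.pow_const _).mul (hG.comp measurable_fst)
    rw [lintegral_const_mul _ hm',
      lintegral_rayRegion κ hv hJ hJm (1 - α) hG, mul_left_comm]
    have h1 : ∫⁻ w, rayMass v J (1 - α) w * R w ^ α ∂κ ≤ c := by
      refine lintegral_mono fun w => ?_
      have := rayMass_mul_rpow_le hv hJ 0 1 hα w
      rw [mul_zero, mul_one, zero_add] at this
      have h2 := mul_div_rpow_le (hZ0 0 w) (hZt 0 w) (hZ0 1 w) (hZt 1 w) hα this
      rw [← hRinv, ← mul_assoc] at h2
      calc _ = (rayMass v J (1 - α) w * R w ^ α * (R w)⁻¹) * R w := by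
            rw [mul_assoc _ _ (R w), ENNReal.inv_mul_cancel (hR0 w) (hRt w), mul_one]
        _ ≤ rayMass v J 0 w * R w := by
            gcongr
        _ = _ := ENNReal.mul_div_cancel (hZ0 0 w) (hZt 0 w)
    calc _ ≤ ENNReal.ofReal (Real.exp ((1 - α) * (1 - α - 1) * (Fintype.card ι / (2 * v))))
          * (c⁻¹ * c) := by gcongr
      _ = _ := by
          rw [ENNReal.inv_mul_cancel hc0 hct, mul_one]
          congr 2
          ring
  have hm1 : gaussianProd ι κ v 1 = m.withDensity D := gaussianProd_one_eq κ hv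
  have hdc : d * c⁻¹ ≤ 1 := by
    rw [hm1, withDensity_apply _ hK, hD1] at hd
    rw [← div_eq_mul_inv]
    exact ENNReal.div_le_of_le_mul (by simpa using hd)
  have hPle : d • Pt ≤ (gaussianProd ι κ v 1).restrict (rayRegion J) := by
    rw [hm1, restrict_withDensity hK, hPt, ← withDensity_smul _ ham]
    refine withDensity_mono (ae_of_all _ fun q => ?_)
    simp only [ha, Pi.smul_apply, smul_eq_mul]
    rw [← mul_assoc]
    exact mul_le_of_le_one_left' hdc
  have hQle : d • Qt ≤ m := by
    refine le_trans ?_ (Measure.restrict_le_self (s := rayRegion J))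
    rw [hQt, ← withDensity_smul _ hbm]
    conv_rhs => rw [← withDensity_one (μ := m.restrict (rayRegion J))]
    refine withDensity_mono (ae_of_all _ fun q => ?_)
    simp only [hb, Pi.smul_apply, smul_eq_mul, Pi.one_apply]
    rw [← mul_assoc]
    -- `R ≤ 1`, since lower rays lose mass as the mean grows. Hence `d ≤ c` suffices for `Qt` as
    -- well.
    refine mul_le_one' hdc ?_
    exact ENNReal.div_le_of_le_mul (by simpa using rayMass_anti v hJ zero_le_one q.1)
  have hPmap : Pt.map g₁ = Pt.map g := by
    refine Measure.map_congr ?_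
    have h1 : ∀ᵐ q ∂(m.restrict (rayRegion J)), q ∈ rayRegion J := ae_restrict_mem hK
    filter_upwards [(withDensity_absolutelyContinuous _ a).ae_le h1] with q hq using hgg q hq
  have hρ : (0 : ℝ) ≤ Fintype.card ι / (2 * v) := by positivity
  have : IsProbabilityMeasure (Qt.withDensity p) := hPQ ▸ hPprob
  have : IsProbabilityMeasure (Pt.withDensity r) := hQP ▸ hQprob
  refine ⟨Pt.map g, Qt.map g, Measure.isProbabilityMeasure_map hg.aemeasurable,
    Measure.isProbabilityMeasure_map hg.aemeasurable, ?_, ?_, fun α hα => ⟨?_, ?_⟩⟩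
  · rw [← hPmap, ← Measure.map_smul]
    exact Measure.map_mono (hPle.trans Measure.restrict_le_self) hg₁
  · rw [← Measure.map_smul]
    exact Measure.map_mono hQle hg
  · have := renyiDiv_map_le hpm hg hρ hPmom hα
    rwa [← hPQ] at this
  · have := renyiDiv_map_le hrm hg hρ hQmom hα
    rwa [← hQP] at this

end Truncation

/-! ### Dyadic blocks -/

lemma mem_dyadicBlocks {r : ℕ} {I : ℕ × ℕ} :
    I ∈ dyadicBlocks r ↔ ∃ j, r / 2 ^ j % 2 = 1 ∧
      I = (r / 2 ^ (j + 1) * 2 ^ (j + 1), r / 2 ^ (j + 1) * 2 ^ (j + 1) + 2 ^ j) := by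
  simp only [dyadicBlocks, Finset.mem_image, Finset.mem_filter, Finset.mem_range,
    Nat.testBit_eq_decide_div_mod_eq, decide_eq_true_eq]
  constructor
  · rintro ⟨j, ⟨-, h⟩, rfl⟩
    exact ⟨j, h, rfl⟩
  · rintro ⟨j, h, rfl⟩
    refine ⟨j, ⟨Nat.lt_size.2 ?_, h⟩, rfl⟩
    by_contra hlt
    rw [Nat.div_eq_of_lt (not_le.1 hlt)] at h
    simp at h

lemma lt_of_div_two_pow_mod {r j n : ℕ} (h : r / 2 ^ j % 2 = 1) (hr : r < 2 ^ n) : j < n := by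
  by_contra hjn
  rw [Nat.div_eq_of_lt (hr.trans_le (Nat.pow_le_pow_right two_pos (not_lt.1 hjn)))] at h
  simp at h

lemma snd_le_of_mem_dyadicBlocks {r : ℕ} {I : ℕ × ℕ} (hI : I ∈ dyadicBlocks r) : I.2 ≤ r := by
  obtain ⟨j, hj, rfl⟩ := mem_dyadicBlocks.1 hI
  have h1 : r / 2 ^ (j + 1) = r / 2 ^ j / 2 := by rw [pow_succ, Nat.div_div_eq_div_mul]
  have h2 : r / 2 ^ j = 2 * (r / 2 ^ j / 2) + 1 := by omega
  have h3 : r / 2 ^ j * 2 ^ j ≤ r := Nat.div_mul_le_self _ _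
  dsimp only
  rw [h1, pow_succ]
  calc r / 2 ^ j / 2 * (2 ^ j * 2) + 2 ^ j = (2 * (r / 2 ^ j / 2) + 1) * 2 ^ j := by ring
    _ = r / 2 ^ j * 2 ^ j := by rw [← h2]
    _ ≤ r := h3

/-- A block of `r` at the bit `j` contains the round `l + 1` if and only if `j` is the most
significant bit at which `l` and `r` differ. -/
lemma mem_block_iff {r j l : ℕ} (hj : r / 2 ^ j % 2 = 1) :
    (r / 2 ^ (j + 1) * 2 ^ (j + 1) < l + 1 ∧
      l + 1 ≤ r / 2 ^ (j + 1) * 2 ^ (j + 1) + 2 ^ j) ↔ l / 2 ^ j + 1 = r / 2 ^ j := by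
  have h1 : r / 2 ^ (j + 1) = r / 2 ^ j / 2 := by rw [pow_succ, Nat.div_div_eq_div_mul]
  have h2 : r / 2 ^ j = 2 * (r / 2 ^ j / 2) + 1 := by omega
  rw [h1]
  generalize r / 2 ^ j / 2 = q at *
  rw [h2, add_left_inj, Nat.div_eq_iff (by positivity), pow_succ]
  have h3 : q * (2 ^ j * 2) = 2 ^ j * (2 * q) := by ring
  have h4 : 0 < 2 ^ j := by positivity
  rw [h3, mul_comm (2 * q)]
  omega

lemma div_two_pow_eq_of_le {l r j k : ℕ} (hjk : j ≤ k) (h : l / 2 ^ j = r / 2 ^ j) :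
    l / 2 ^ k = r / 2 ^ k := by
  obtain ⟨d, rfl⟩ := Nat.exists_eq_add_of_le hjk
  rw [pow_add, ← Nat.div_div_eq_div_mul, ← Nat.div_div_eq_div_mul, h]

/-- The block belongs to the most significant bit `j` at which `l` and `r` differ; `j + 1` is the
least shift after which they coincide. -/
lemma existsUnique_mem_dyadicBlocks {l r : ℕ} (hlr : l < r) :
    ∃! I, I ∈ dyadicBlocks r ∧ I.1 < l + 1 ∧ l + 1 ≤ I.2 := by
  have hex : ∃ k, l / 2 ^ k = r / 2 ^ k :=
    ⟨r, by rw [Nat.div_eq_of_lt (hlr.trans Nat.lt_two_pow_self), Nat.div_eq_of_lt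
      Nat.lt_two_pow_self]⟩
  have huniq : ∀ j k, r / 2 ^ j % 2 = 1 → l / 2 ^ j + 1 = r / 2 ^ j → l / 2 ^ k + 1 = r / 2 ^ k →
      ¬ j < k := by
    intro j k hj h1 h2 hjk
    have h3 : l / 2 ^ (j + 1) = r / 2 ^ (j + 1) := by
      rw [pow_succ, ← Nat.div_div_eq_div_mul, ← Nat.div_div_eq_div_mul]
      omega
    have := div_two_pow_eq_of_le hjk h3
    omega
  classical
  obtain ⟨j, hj⟩ : ∃ j, Nat.find hex = j + 1 := by
    refine Nat.exists_eq_succ_of_ne_zero fun h0 => ?_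
    have := Nat.find_spec hex
    rw [h0] at this
    simp at this
    omega
  have h1 : l / 2 ^ (j + 1) = r / 2 ^ (j + 1) := hj ▸ Nat.find_spec hex
  have h2 : l / 2 ^ j ≠ r / 2 ^ j := Nat.find_min hex (by omega)
  have h3 : l / 2 ^ j ≤ r / 2 ^ j := Nat.div_le_div_right hlr.le
  rw [pow_succ, ← Nat.div_div_eq_div_mul, ← Nat.div_div_eq_div_mul] at h1
  have h4 : r / 2 ^ j % 2 = 1 := by omega
  refine ⟨_, ⟨mem_dyadicBlocks.2 ⟨j, h4, rfl⟩, (mem_block_iff h4).2 (by omega)⟩, ?_⟩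
  rintro I ⟨hI, hl⟩
  obtain ⟨k, hk, rfl⟩ := mem_dyadicBlocks.1 hI
  have h5 := (mem_block_iff hk).1 hl
  have h6 : l / 2 ^ j + 1 = r / 2 ^ j := by omega
  rw [le_antisymm (not_lt.1 (huniq j k h4 h6 h5)) (not_lt.1 (huniq k j hk h5 h6))]

lemma card_dyadicBlocks_le {r n : ℕ} (hr : r < 2 ^ n) : (dyadicBlocks r).card ≤ n := by
  have hsub : dyadicBlocks r ⊆ (Finset.range n).image fun j =>
      (r / 2 ^ (j + 1) * 2 ^ (j + 1), r / 2 ^ (j + 1) * 2 ^ (j + 1) + 2 ^ j) := by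
    intro I hI
    obtain ⟨j, hj, rfl⟩ := mem_dyadicBlocks.1 hI
    exact Finset.mem_image.2 ⟨j, Finset.mem_range.2 (lt_of_div_two_pow_mod hj hr), rfl⟩
  exact (Finset.card_le_card hsub).trans (Finset.card_image_le.trans (by simp))

/-- The blocks of the rounds up to `L` that contain the round `l + 1`. -/
def coveringBlocks (L l : ℕ) : Finset (ℕ × ℕ) :=
  ((Finset.range (L + 1)).biUnion dyadicBlocks).filter fun I => I.1 < l + 1 ∧ l + 1 ≤ I.2

lemma mem_coveringBlocks {L l r : ℕ} {I : ℕ × ℕ} (hI : I ∈ dyadicBlocks r) (hr : r ≤ L) :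
    I ∈ coveringBlocks L l ↔ I.1 < l + 1 ∧ l + 1 ≤ I.2 := by
  simp only [coveringBlocks, Finset.mem_filter, Finset.mem_biUnion, Finset.mem_range,
    and_iff_right_iff_imp]
  exact fun _ => ⟨r, by omega, hI⟩

/-- Above bit `j` the numbers `l` and `r` agree, so a covering block of length `2 ^ j` is determined
by `l` and `j` alone. -/
lemma card_coveringBlocks_le {L n : ℕ} (hL : L < 2 ^ n) (l : ℕ) :
    (coveringBlocks L l).card ≤ n := by
  have hsub : coveringBlocks L l ⊆ (Finset.range n).image fun j =>
      (l / 2 ^ (j + 1) * 2 ^ (j + 1), l / 2 ^ (j + 1) * 2 ^ (j + 1) + 2 ^ j) := by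
    intro I hI
    simp only [coveringBlocks, Finset.mem_filter, Finset.mem_biUnion, Finset.mem_range] at hI
    obtain ⟨⟨r, hr, hI⟩, hl⟩ := hI
    obtain ⟨j, hj, rfl⟩ := mem_dyadicBlocks.1 hI
    have h1 := (mem_block_iff hj).1 hl
    have h2 : l / 2 ^ (j + 1) = r / 2 ^ (j + 1) := by
      rw [pow_succ, ← Nat.div_div_eq_div_mul, ← Nat.div_div_eq_div_mul]
      omega
    exact Finset.mem_image.2 ⟨j, Finset.mem_range.2 (lt_of_div_two_pow_mod hj (by omega)),
      by rw [h2]⟩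
  exact (Finset.card_le_card hsub).trans (Finset.card_image_le.trans (by simp))

/-! ### Noise -/

instance (U : Type*) (σ : ℝ) : IsProbabilityMeasure (noiseLaw U σ) := by
  unfold noiseLaw
  infer_instance

lemma noiseLaw_map_sum (U : Type*) (σ : ℝ) (s : Finset ((ℕ × ℕ) × U)) :
    (noiseLaw U σ).map (fun z => ∑ i ∈ s, z i) = gaussianReal 0 (s.card * (σ ^ 2).toNNReal) := by
  classical
  have hind : iIndepFun (fun i (z : (ℕ × ℕ) × U → ℝ) => z i) (noiseLaw U σ) :=
    iIndepFun_infinitePi (X := fun _ x => x) fun _ => measurable_id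
  induction s using Finset.induction_on with
  | empty => simp
  | insert i s hi ih =>
    have h1 : (noiseLaw U σ).map (fun z => z i) = gaussianReal 0 (σ ^ 2).toNNReal :=
      Measure.infinitePi_map_eval _ i
    have h2 := (hind.indepFun_finsetSum_of_notMem (fun i => measurable_pi_apply i) hi).symm
    have e : (∑ j ∈ s, fun z : (ℕ × ℕ) × U → ℝ => z j) = fun z => ∑ j ∈ s, z j := by
      ext z
      simp
    rw [e] at h2
    have h3 := gaussianReal_add_gaussianReal_of_indepFun h2 h1 ih
    have e2 : (fun z : (ℕ × ℕ) × U → ℝ => ∑ j ∈ insert i s, z j)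
        = (fun z => z i) + fun z => ∑ j ∈ s, z j := by
      ext z
      simp [Finset.sum_insert hi]
    rw [e2, h3, Finset.card_insert_of_notMem hi]
    congr 1
    · simp
    · push_cast
      ring

/-- The noise vector with the coordinates in `F` taken from the second component, minus `β`. -/
noncomputable def spliceNoise {U : Type*} (F : Finset ((ℕ × ℕ) × U)) (β : ℝ)
    (q : ((ℕ × ℕ) × U → ℝ) × (F → ℝ)) : (ℕ × ℕ) × U → ℝ :=
  open Classical in
  fun i => if hi : i ∈ F then q.2 ⟨i, hi⟩ - β else q.1 i

lemma measurable_spliceNoise {U : Type*} (F : Finset ((ℕ × ℕ) × U)) (β : ℝ) :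
    Measurable (spliceNoise F β) := by
  refine measurable_pi_lambda _ fun i => ?_
  unfold spliceNoise
  split_ifs <;> fun_prop

/-- Subtracting `β` recentres the spliced coordinates, and the entries of the first component that
they replace are simply discarded. So either mechanism may be represented with its own `β`. -/
lemma gaussianProd_map_spliceNoise {U : Type*} (F : Finset ((ℕ × ℕ) × U)) (σ β : ℝ) :
    (gaussianProd F (noiseLaw U σ) (σ ^ 2).toNNReal β).map (spliceNoise F β) = noiseLaw U σ := by
  classical
  conv_rhs => rw [noiseLaw]
  refine Measure.eq_infinitePi _ fun s t ht => ?_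
  have hpre : spliceNoise F β ⁻¹' (Set.pi s t)
      = (Set.pi (s \ F : Finset _) t) ×ˢ
        (Set.univ.pi fun i : F => if i.1 ∈ s then (fun x => x - β) ⁻¹' t i.1 else Set.univ) := by
    ext q
    simp only [Set.mem_preimage, Set.mem_pi, Set.mem_prod, Finset.mem_coe, Finset.mem_sdiff,
      Set.mem_univ, true_implies, spliceNoise]
    constructor
    · intro h
      refine ⟨fun i hi => by simpa [hi.2] using h i hi.1, fun i => ?_⟩
      split_ifs with his
      · simpa using h i.1 his
      · trivial
    · rintro ⟨h1, h2⟩ i hi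
      by_cases hiF : i ∈ F
      · simpa [hiF, hi] using h2 ⟨i, hiF⟩
      · simpa [hiF] using h1 i ⟨hi, hiF⟩
  rw [Measure.map_apply (measurable_spliceNoise F β)
    (MeasurableSet.pi (Finset.countable_toSet s) fun i _ => ht i), hpre, gaussianProd,
    Measure.prod_prod, noiseLaw, Measure.infinitePi_pi _ fun i _ => ht i, Measure.pi_pi]
  have hshift : ∀ i, gaussianReal β (σ ^ 2).toNNReal ((fun x => x - β) ⁻¹' t i)
      = gaussianReal 0 (σ ^ 2).toNNReal (t i) := fun i => by
    rw [← Measure.map_apply (by fun_prop) (ht i), gaussianReal_map_sub_const, sub_self]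
  have hF : ∏ i : F, gaussianReal β (σ ^ 2).toNNReal
      (if i.1 ∈ s then (fun x => x - β) ⁻¹' t i.1 else Set.univ)
      = ∏ i ∈ s ∩ F, gaussianReal 0 (σ ^ 2).toNNReal (t i) := by
    rw [Finset.prod_coe_sort F fun i => gaussianReal β (σ ^ 2).toNNReal
      (if i ∈ s then (fun x => x - β) ⁻¹' t i else Set.univ), Finset.inter_comm,
      ← Finset.filter_mem_eq_inter, Finset.prod_filter]
    refine Finset.prod_congr rfl fun i _ => ?_
    split_ifs
    · exact hshift i
    · exact measure_univ
  rw [hF, mul_comm, Finset.prod_inter_mul_prod_sdiff]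

lemma isLowerRay_setOf_forall {C : Type*} (R : Finset C) (p : C → Prop) (s : C → ℝ) :
    IsLowerRay {x | ∀ c ∈ R, p c → x ≤ s c} := by
  classical
  induction R using Finset.induction_on with
  | empty => exact .inr (by simp)
  | insert c R hc ih =>
    have e : {x | ∀ c' ∈ insert c R, p c' → x ≤ s c'}
        = {x | p c → x ≤ s c} ∩ {x | ∀ c ∈ R, p c → x ≤ s c} := by
      ext x
      simp
    rw [e]
    by_cases hp : p c
    · have e2 : {x | p c → x ≤ s c} = Set.Iic (s c) := by
        ext x
        simp [hp]
      rw [e2]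
      rcases ih with ⟨t, ht⟩ | ht
      · exact .inl ⟨min (s c) t, by rw [ht, Set.Iic_inter_Iic]⟩
      · exact .inl ⟨s c, by rw [ht, Set.inter_univ]⟩
    · simpa [hp] using ih

/-! ### Adjacent streams -/

section Adjacent

variable {U : Type*} {L : ℕ} {ω ω' : Fin L → Finset U} {l : Fin L}

/-- The noise coordinates that compensate for the items of the round `l`. -/
def shiftedCoords (ω : Fin L → Finset U) (l : Fin L) : Finset ((ℕ × ℕ) × U) :=
  coveringBlocks L l ×ˢ ω l

lemma mem_shiftedCoords {r : ℕ} {I : ℕ × ℕ} (hI : I ∈ dyadicBlocks r) (hr : r ≤ L) (u : U) :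
    (I, u) ∈ shiftedCoords ω l ↔ (I.1 < l + 1 ∧ l + 1 ≤ I.2) ∧ u ∈ ω l := by
  rw [shiftedCoords, Finset.mem_product, mem_coveringBlocks hI hr]

open Classical in
lemma partialSum_eq_add (hagree : ∀ i, i ≠ l → ω i = ω' i) (hempty : ω' l = ∅) (u : U)
    (I : ℕ × ℕ) :
    partialSum ω u I = partialSum ω' u I +
      if (I.1 < l + 1 ∧ l + 1 ≤ I.2) ∧ u ∈ ω l then 1 else 0 := by
  unfold partialSum
  split_ifs with h
  · rw [← Finset.card_insert_of_notMem (a := l) (by simp [hempty])]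
    congr 1
    ext i
    rcases eq_or_ne i l with rfl | hi
    · simpa [h.2, Nat.lt_succ_iff] using h.1
    · simp [hi, hagree i hi]
  · rw [add_zero]
    congr 1
    ext i
    rcases eq_or_ne i l with rfl | hi
    · simp only [hempty, Finset.mem_filter, Finset.mem_univ, true_and, Finset.notMem_empty,
        and_false, iff_false]
      tauto
    · simp [hagree i hi]

/-- The extra 1 in a partial sum of `ω` occurs exactly at the shifted coordinates, where the splice
with `β = 1` subtracts it. -/
lemma noisyCount_spliceNoise_eq (hagree : ∀ i, i ≠ l → ω i = ω' i) (hempty : ω' l = ∅)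
    (q : ((ℕ × ℕ) × U → ℝ) × (shiftedCoords ω l → ℝ)) {r : ℕ} (hr : r ≤ L) (u : U) :
    noisyCount ω (spliceNoise (shiftedCoords ω l) 1 q) r u
      = noisyCount ω' (spliceNoise (shiftedCoords ω l) 0 q) r u := by
  refine Finset.sum_congr rfl fun I hI => ?_
  rw [partialSum_eq_add hagree hempty]
  unfold spliceNoise
  have := mem_shiftedCoords (ω := ω) (l := l) hI hr u
  split_ifs with h1 h2 h2
  · push_cast
    ring
  · exact absurd (this.2 h1) h2
  · exact absurd (this.1 h2) h1
  · simp

/-- Only one block of `r` covers round `l + 1`, so a count depends on a single spliced coordinate,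
with slope 1. This is what turns a bound on the count into a ray. -/
lemma noisyCount_spliceNoise_add (w : (ℕ × ℕ) × U → ℝ) (x : shiftedCoords ω l → ℝ) {r : ℕ}
    (hlr : l < r) (hr : r ≤ L) (f : shiftedCoords ω l) (hf : f.1.1 ∈ dyadicBlocks r) :
    noisyCount ω' (spliceNoise (shiftedCoords ω l) 0 (w, x)) r f.1.2
      = x f + noisyCount ω' (spliceNoise (shiftedCoords ω l) 0 (w, 0)) r f.1.2 := by
  classical
  have hfl := (mem_shiftedCoords hf hr f.1.2).1 f.2
  unfold noisyCount
  rw [← Finset.add_sum_erase _ _ hf, ← Finset.add_sum_erase _ _ hf, ← add_assoc]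
  congr 1
  · simp [spliceNoise]
    ring
  · refine Finset.sum_congr rfl fun I hI => ?_
    rw [Finset.mem_erase] at hI
    have hIF : (I, f.1.2) ∉ shiftedCoords ω l := fun h =>
      hI.1 ((existsUnique_mem_dyadicBlocks hlr).unique
        ⟨hI.2, ((mem_shiftedCoords hI.2 hr _).1 h).1⟩ ⟨hf, hfl.1⟩)
    simp [spliceNoise, hIF]

open Classical in
/-- The items and rounds in which the stream `ω`, but not `ω'`, may release the item. -/
noncomputable def exposedPairs (ω ω' : Fin L → Finset U) (l : Fin L) : Finset (U × Fin L) :=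
  (ω l ×ˢ Finset.univ).filter fun c => l ≤ c.2 ∧ ∀ j ≤ c.2, c.1 ∉ ω' j

lemma mem_exposedPairs {c : U × Fin L} :
    c ∈ exposedPairs ω ω' l ↔ c.1 ∈ ω l ∧ l ≤ c.2 ∧ ∀ j ≤ c.2, c.1 ∉ ω' j := by
  simp [exposedPairs]

lemma card_exposedPairs_le : (exposedPairs ω ω' l).card ≤ (ω l).card * L := by
  classical
  refine (Finset.card_filter_le _ _).trans ?_
  rw [Finset.card_product, Finset.card_univ, Fintype.card_fin]

/-- The values of a noise coordinate for which no exposed pair is released. -/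
def safeRay (T : ℝ) (ω ω' : Fin L → Finset U) (l : Fin L) (f : shiftedCoords ω l)
    (w : (ℕ × ℕ) × U → ℝ) : Set ℝ :=
  {x | ∀ c ∈ exposedPairs ω ω' l, (f.1.2 = c.1 ∧ f.1.1 ∈ dyadicBlocks (c.2 + 1)) →
    x ≤ T - noisyCount ω' (spliceNoise (shiftedCoords ω l) 0 (w, 0)) (c.2 + 1) c.1}

lemma measurableSet_safeRay (T : ℝ) (f : shiftedCoords ω l) :
    MeasurableSet {q : ((ℕ × ℕ) × U → ℝ) × ℝ | q.2 ∈ safeRay T ω ω' l f q.1} := by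
  have e : {q : ((ℕ × ℕ) × U → ℝ) × ℝ | q.2 ∈ safeRay T ω ω' l f q.1}
      = ⋂ c ∈ exposedPairs ω ω' l,
        {q | (f.1.2 = c.1 ∧ f.1.1 ∈ dyadicBlocks (c.2 + 1)) → q.2 ≤ T -
          noisyCount ω' (spliceNoise (shiftedCoords ω l) 0 (q.1, 0)) (c.2 + 1) c.1} := by
    ext q
    simp [safeRay]
  rw [e]
  refine Finset.measurableSet_biInter _ fun c _ => MeasurableSet.imp (MeasurableSet.const _) ?_
  have hm : Measurable fun q : ((ℕ × ℕ) × U → ℝ) × ℝ =>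
      noisyCount ω' (spliceNoise (shiftedCoords ω l) 0 (q.1, 0)) (c.2 + 1) c.1 :=
    (measurable_noisyCount ω' _ _).comp
      ((measurable_spliceNoise _ 0).comp (measurable_fst.prodMk measurable_const))
  exact measurableSet_le measurable_snd (hm.const_sub T)

lemma mem_rayRegion_safeRay {T : ℝ} {q : ((ℕ × ℕ) × U → ℝ) × (shiftedCoords ω l → ℝ)} :
    q ∈ rayRegion (safeRay T ω ω' l) ↔ ∀ c ∈ exposedPairs ω ω' l,
      noisyCount ω' (spliceNoise (shiftedCoords ω l) 0 q) (c.2 + 1) c.1 ≤ T := by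
  constructor
  · rintro hq ⟨u, i⟩ hc
    have hc' := mem_exposedPairs.1 hc
    have hlt : (l : ℕ) < i + 1 := Nat.lt_succ_of_le hc'.2.1
    obtain ⟨I, ⟨hI, hl⟩, -⟩ := existsUnique_mem_dyadicBlocks hlt
    have hF : (I, u) ∈ shiftedCoords ω l :=
      (mem_shiftedCoords hI i.2 u).2 ⟨hl, hc'.1⟩
    have h1 := noisyCount_spliceNoise_add (ω' := ω') q.1 q.2 hlt i.2 ⟨(I, u), hF⟩ hI
    have h2 := hq ⟨(I, u), hF⟩ ⟨u, i⟩ hc ⟨rfl, hI⟩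
    dsimp only at h1 h2 ⊢
    rw [show q = (q.1, q.2) from rfl, h1]
    linarith
  · rintro h f ⟨u, i⟩ hc ⟨hu, hI⟩
    have hc' := mem_exposedPairs.1 hc
    have hlt : (l : ℕ) < i + 1 := Nat.lt_succ_of_le hc'.2.1
    have h1 := noisyCount_spliceNoise_add (ω' := ω') q.1 q.2 hlt i.2 f hI
    have h2 := h _ hc
    dsimp only at hu h1 h2 ⊢
    rw [← hu] at h2 ⊢
    rw [show q = (q.1, q.2) from rfl, h1] at h2
    linarith

/-- The counts agree everywhere; only the test whether an item has occurred can differ. It differs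
just at exposed pairs, which the region keeps at or below `T`. -/
lemma release_spliceNoise_eq (hagree : ∀ i, i ≠ l → ω i = ω' i) (hempty : ω' l = ∅) {T : ℝ}
    {q : ((ℕ × ℕ) × U → ℝ) × (shiftedCoords ω l → ℝ)}
    (hq : q ∈ rayRegion (safeRay T ω ω' l)) :
    release T ω (spliceNoise (shiftedCoords ω l) 1 q)
      = release T ω' (spliceNoise (shiftedCoords ω l) 0 q) := by
  classical
  ext1 i
  ext1 u
  simp only [release]
  rw [noisyCount_spliceNoise_eq hagree hempty q i.2]
  refine if_congr (and_congr_left fun hT => ⟨?_, ?_⟩) rfl rfl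
  · rintro ⟨j, hji, hj⟩
    rcases eq_or_ne j l with rfl | hjl
    · by_contra! hno
      exact absurd hT (not_lt.2 (mem_rayRegion_safeRay.1 hq (u, i)
        (mem_exposedPairs.2 ⟨hj, hji, hno⟩)))
    · exact ⟨j, hji, hagree j hjl ▸ hj⟩
  · rintro ⟨j, hji, hj⟩
    rcases eq_or_ne j l with rfl | hjl
    · simp [hempty] at hj
    · exact ⟨j, hji, hagree j hjl ▸ hj⟩

/-- Up to the given round, an exposed item occurs in `ω` in round `l` only, so its exact count is 1;
this is the leading 1 of the threshold. -/
lemma noisyCount_of_mem_exposedPairs (hagree : ∀ i, i ≠ l → ω i = ω' i) (hempty : ω' l = ∅)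
    {c : U × Fin L} (hc : c ∈ exposedPairs ω ω' l) (z : (ℕ × ℕ) × U → ℝ) :
    noisyCount ω z (c.2 + 1) c.1
      = 1 + ∑ i ∈ dyadicBlocks (c.2 + 1) ×ˢ {c.1}, z i := by
  classical
  obtain ⟨hu, hl, hno⟩ := mem_exposedPairs.1 hc
  rw [noisyCount, Finset.sum_add_distrib, Finset.sum_product]
  simp only [Finset.sum_singleton, add_left_inj]
  have h0 : ∀ I ∈ dyadicBlocks (c.2 + 1), partialSum ω' c.1 I = 0 := by
    intro I hI
    have := snd_le_of_mem_dyadicBlocks hI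
    rw [partialSum, Finset.card_eq_zero, Finset.filter_eq_empty_iff]
    rintro j - ⟨-, h2, h3⟩
    exact hno j (Fin.le_def.2 (by omega)) h3
  obtain ⟨I₀, ⟨hI₀, hl₀⟩, huniq⟩ :=
    existsUnique_mem_dyadicBlocks (l := l) (r := c.2 + 1) (Nat.lt_succ_of_le hl)
  rw [Finset.sum_eq_single_of_mem I₀ hI₀]
  · rw [partialSum_eq_add hagree hempty, h0 I₀ hI₀, if_pos ⟨hl₀, hu⟩]
    simp
  · intro I hI hne
    rw [partialSum_eq_add hagree hempty, h0 I hI, if_neg fun h => hne (huniq I ⟨hI, h.1⟩)]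
    simp

lemma noiseLaw_exposed_le (hagree : ∀ i, i ≠ l → ω i = ω' i) (hempty : ω' l = ∅) {σ η : ℝ}
    (hη : 0 < η) (hη1 : η ≤ 1 / 2) (hσ : 0 ≤ σ) {n : ℕ} (hL : L < 2 ^ n) {c : U × Fin L}
    (hc : c ∈ exposedPairs ω ω' l) :
    noiseLaw U σ {z | 1 + σ * √((n : ℝ) + 1) * normalQuantile (1 - η)
      < noisyCount ω z (c.2 + 1) c.1} ≤ ENNReal.ofReal η := by
  -- At most `n` blocks occur; the additional 1 under the root of the threshold is slack.
  have hcard : (dyadicBlocks (c.2 + 1) ×ˢ {c.1}).card ≤ n + 1 := by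
    rw [Finset.card_product, Finset.card_singleton, mul_one]
    exact (card_dyadicBlocks_le (by have := c.2.2; omega)).trans n.le_succ
  refine le_trans (le_of_eq ?_) (gaussianReal_Ioi_normalQuantile_le hη hη1 hσ hcard)
  rw [← noiseLaw_map_sum, Measure.map_apply (Finset.measurable_fun_sum _ fun i _ =>
    measurable_pi_apply i) measurableSet_Ioi]
  congr 1
  ext z
  simp [noisyCount_of_mem_exposedPairs hagree hempty hc z]

lemma gaussianProd_rayRegion_safeRay (hagree : ∀ i, i ≠ l → ω i = ω' i) (hempty : ω' l = ∅)
    {σ η : ℝ} (hη : 0 < η) (hη1 : η ≤ 1 / 2) (hσ : 0 ≤ σ) {n : ℕ} (hL : L < 2 ^ n) {δ : ℝ}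
    (hδ0 : 0 ≤ δ) (hδ : (ω l).card * L * η ≤ δ) :
    ENNReal.ofReal (1 - δ) ≤ gaussianProd (shiftedCoords ω l) (noiseLaw U σ) (σ ^ 2).toNNReal 1
      (rayRegion (safeRay (1 + σ * √((n : ℝ) + 1) * normalQuantile (1 - η)) ω ω' l)) := by
  set T := 1 + σ * √((n : ℝ) + 1) * normalQuantile (1 - η) with hT
  set μ := gaussianProd (shiftedCoords ω l) (noiseLaw U σ) (σ ^ 2).toNNReal 1 with hμ
  have hK : MeasurableSet (rayRegion (safeRay T ω ω' l)) :=
    measurableSet_rayRegion (measurableSet_safeRay T)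
  have hcompl : μ (rayRegion (safeRay T ω ω' l))ᶜ ≤ ENNReal.ofReal δ := by
    -- The region is phrased with counts of `ω'`; passing to those of `ω` with `β = 1` turns the
    -- spliced vector into genuine centred noise, to which the tail bound applies.
    have hsub : (rayRegion (safeRay T ω ω' l))ᶜ ⊆ ⋃ c ∈ exposedPairs ω ω' l,
        spliceNoise (shiftedCoords ω l) 1 ⁻¹' {z | T < noisyCount ω z (c.2 + 1) c.1} := by
      intro q hq
      rw [Set.mem_compl_iff, mem_rayRegion_safeRay] at hq
      push Not at hq
      obtain ⟨c, hc, hlt⟩ := hq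
      simp only [Set.mem_iUnion, Set.mem_preimage]
      refine ⟨c, hc, ?_⟩
      change T < _
      rwa [noisyCount_spliceNoise_eq hagree hempty q c.2.2]
    calc μ (rayRegion (safeRay T ω ω' l))ᶜ
        ≤ ∑ c ∈ exposedPairs ω ω' l, μ (spliceNoise (shiftedCoords ω l) 1 ⁻¹'
            {z | T < noisyCount ω z (c.2 + 1) c.1}) :=
          (measure_mono hsub).trans (measure_biUnion_finset_le _ _)
      _ ≤ ∑ c ∈ exposedPairs ω ω' l, ENNReal.ofReal η := by
          refine Finset.sum_le_sum fun c hc => ?_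
          rw [← Measure.map_apply (measurable_spliceNoise _ _)
            (measurableSet_lt measurable_const (measurable_noisyCount ω _ _)), hμ,
            gaussianProd_map_spliceNoise]
          exact noiseLaw_exposed_le hagree hempty hη hη1 hσ hL hc
      _ = ENNReal.ofReal ((exposedPairs ω ω' l).card * η) := by
          rw [Finset.sum_const, nsmul_eq_mul, ENNReal.ofReal_mul (by positivity),
            ENNReal.ofReal_natCast]
      _ ≤ ENNReal.ofReal δ := by
          refine ENNReal.ofReal_le_ofReal (le_trans ?_ hδ)
          gcongr
          exact_mod_cast card_exposedPairs_le
  have h1 := prob_compl_eq_one_sub (μ := μ) hK.compl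
  rw [compl_compl] at h1
  rw [h1, ENNReal.ofReal_sub _ hδ0, ENNReal.ofReal_one]
  exact tsub_le_tsub_left hcompl 1

lemma binaryMechanism_eq_map {Δ₀ : ℕ} (σ T β : ℝ) (ω : EventStream U L Δ₀)
    (F : Finset ((ℕ × ℕ) × U)) :
    (gaussianProd F (noiseLaw U σ) (σ ^ 2).toNNReal β).map
      (fun q => release T ω.1 (spliceNoise F β q)) = binaryMechanism σ T ω := by
  rw [binaryMechanism]
  conv_rhs => rw [← gaussianProd_map_spliceNoise F σ β]
  rw [Measure.map_map (measurable_release T ω.1) (measurable_spliceNoise F β)]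
  rfl

/-- The privacy guarantee for streams of which the second one lacks an event. -/
theorem exists_mixture_of_removed_event {Δ₀ : ℕ} {ω ω' : EventStream U L Δ₀} {l : Fin L}
    (hagree : ∀ i, i ≠ l → ω.1 i = ω'.1 i) (hempty : ω'.1 l = ∅) {σ δ : ℝ} (hσ : 0 < σ)
    (hδ : 0 < δ) (hδ1 : δ ≤ 1) (hδL : δ ≤ (Δ₀ : ℝ) * L / 2) {n : ℕ} (hL : L < 2 ^ n) :
    ∃ P' P'' Q' Q'' : Measure (Release U L),
      IsProbabilityMeasure P' ∧ IsProbabilityMeasure P'' ∧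
      IsProbabilityMeasure Q' ∧ IsProbabilityMeasure Q'' ∧
      binaryMechanism σ (1 + σ * √((n : ℝ) + 1) * normalQuantile (1 - δ / (Δ₀ * L))) ω
        = ENNReal.ofReal (1 - δ) • P' + ENNReal.ofReal δ • P'' ∧
      binaryMechanism σ (1 + σ * √((n : ℝ) + 1) * normalQuantile (1 - δ / (Δ₀ * L))) ω'
        = ENNReal.ofReal (1 - δ) • Q' + ENNReal.ofReal δ • Q'' ∧
      ∀ α : ℝ, 1 ≤ α →
        renyiDiv α P' Q' ≤ ((Δ₀ * n * (1 / σ) ^ 2 / 2 * α : ℝ) : EReal) ∧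
        renyiDiv α Q' P' ≤ ((Δ₀ * n * (1 / σ) ^ 2 / 2 * α : ℝ) : EReal) := by
  have hpos : 0 < (Δ₀ : ℝ) * L := by linarith
  set T := 1 + σ * √((n : ℝ) + 1) * normalQuantile (1 - δ / (Δ₀ * L)) with hT
  have hv : (σ ^ 2).toNNReal ≠ 0 := by simpa using hσ.ne'
  have hregion := gaussianProd_rayRegion_safeRay (η := δ / (Δ₀ * L)) (δ := δ) hagree hempty
    (by positivity) (by rw [div_le_iff₀ hpos]; linarith) hσ.le hL hδ.le (by
      calc ((ω.1 l).card : ℝ) * L * (δ / (Δ₀ * L)) ≤ Δ₀ * L * (δ / (Δ₀ * L)) := by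
            gcongr
            exact_mod_cast ω.2 l
        _ = δ := mul_div_cancel₀ _ hpos.ne')
  obtain ⟨P, Q, hP, hQ, hPle, hQle, hren⟩ := exists_renyiDiv_le (noiseLaw U σ) hv
    (fun f w => isLowerRay_setOf_forall _ _ _) (measurableSet_safeRay T)
    ((measurable_release T ω'.1).comp (measurable_spliceNoise (shiftedCoords ω.1 l) 0))
    ((measurable_release T ω.1).comp (measurable_spliceNoise (shiftedCoords ω.1 l) 1))
    (fun q hq => release_spliceNoise_eq hagree hempty hq) hregion
  have hA := binaryMechanism_eq_map σ T 1 ω (shiftedCoords ω.1 l)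
  have hA' := binaryMechanism_eq_map σ T 0 ω' (shiftedCoords ω.1 l)
  obtain ⟨P'', hP'', hPeq⟩ := exists_mixture hδ hδ1 (hPle.trans_eq hA)
  obtain ⟨Q'', hQ'', hQeq⟩ := exists_mixture hδ hδ1 (hQle.trans_eq hA')
  have hcard : ((shiftedCoords ω.1 l).card : ℝ) ≤ Δ₀ * n := by
    rw [shiftedCoords, Finset.card_product, mul_comm]
    exact_mod_cast Nat.mul_le_mul (ω.2 l) (card_coveringBlocks_le hL l)
  refine ⟨P, P'', Q, Q'', hP, hP'', hQ, hQ'', hPeq, hQeq, fun α hα => ?_⟩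
  have hle : (Fintype.card (shiftedCoords ω.1 l) : ℝ) / (2 * ((σ ^ 2).toNNReal : ℝ)) * α
      ≤ Δ₀ * n * (1 / σ) ^ 2 / 2 * α := by
    rw [Fintype.card_coe, Real.coe_toNNReal _ (sq_nonneg σ)]
    have e : (Δ₀ : ℝ) * n * (1 / σ) ^ 2 / 2 = Δ₀ * n / (2 * σ ^ 2) := by
      field_simp
    rw [e]
    gcongr
  exact ⟨(hren α hα).1.trans (EReal.coe_le_coe_iff.2 hle),
    (hren α hα).2.trans (EReal.coe_le_coe_iff.2 hle)⟩

end Adjacent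

/-! ### Number of bits and conclusion -/

lemma lt_two_pow_natCeil_logb (L : ℕ) : L < 2 ^ ⌈Real.logb 2 ((L : ℝ) + 1)⌉₊ := by
  have h := Nat.le_ceil (Real.logb 2 ((L : ℝ) + 1))
  rw [Real.logb_le_iff_le_rpow one_lt_two (by positivity), Real.rpow_natCast] at h
  exact_mod_cast h

end UnknownDomain

theorem mainTheorem5 {U : Type*} (L Δ₀ : ℕ) (ε δ σ T : ℝ) (hε : 0 < ε)
    (hδ : 0 < δ) (hδ1 : δ ≤ 1) (hδL : δ ≤ (Δ₀ : ℝ) * (L : ℝ) / 2)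
    (hσ : σ = 1 / ε)
    (hT : T = 1 + σ * √((⌈Real.logb 2 ((L : ℝ) + 1)⌉₊ : ℝ) + 1) *
      UnknownDomain.normalQuantile (1 - δ / ((Δ₀ : ℝ) * (L : ℝ)))) :
    UnknownDomain.IsApproxCDP
      (UnknownDomain.EventAdjacent (U := U) (L := L) (Δ₀ := Δ₀))
      (UnknownDomain.binaryMechanism σ T) δ
      ((Δ₀ : ℝ) * (⌈Real.logb 2 ((L : ℝ) + 1)⌉₊ : ℝ) * ε ^ 2 / 2) := by
  have hσ0 : 0 < σ := by
    rw [hσ]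
    positivity
  have hε' : ε = 1 / σ := by rw [hσ, one_div_one_div]
  have hL := UnknownDomain.lt_two_pow_natCeil_logb L
  subst hT
  rw [hε']
  -- The mixture statement bounds the divergence in both directions, so when the first stream lacks
  -- the event the roles are exchanged.
  rintro ω ω' ⟨l, hagree, hempty | hempty⟩
  · obtain ⟨P', P'', Q', Q'', h1, h2, h3, h4, h5, h6, h7⟩ :=
      UnknownDomain.exists_mixture_of_removed_event (fun i hi => (hagree i hi).symm) hempty hσ0 hδ
        hδ1 hδL hL
    exact ⟨Q', Q'', P', P'', h3, h4, h1, h2, h6, h5, fun α hα => (h7 α hα).symm⟩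
  · exact UnknownDomain.exists_mixture_of_removed_event hagree hempty hσ0 hδ hδ1 hδL hL
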